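/- \textbf{Brauer graph algebras.} Let $K$ be a field. A \emph{Brauer graph} $(\Delta,\mathfrak o,m)$ is a finite graph $\Delta$ with at least one edge and no isolated vertices (loops and multiple edges are allowed; connectedness is not required), with a cyclic ordering $\mathfrak o$ of the edges around each vertex, in which a loop is listed twice (as its two half-edges, each with its own successor), and a multiplicity $m(\mu)\ge 1$ for each vertex $\mu$. Let $\operatorname{val}(\mu)$ be the number of half-edges at $\mu$. An edge at $\mu$ is \emph{truncated at $\mu$} if $\operatorname{val}(\mu)=1=m(\mu)$. A \emph{quantization} $q$ assigns $q_{i,\mu}\in K\setminus\{0\}$ to each edge $i$, viewed at an endpoint $\mu$ (that is, to each half-edge), such that $i$ is not truncated at either endpoint. The quiver $\mathcal Q_\Delta$ has the edges of $\Delta$ as vertices, an arrow $i\to j$ for each pair consisting of an edge $i$ not truncated at $\mu$ and its successor $j$ at $\mu$, and in addition one loop $x_i$ at each edge $i$ that is truncated at both endpoints. Let $C_{i,\mu}$ be the cycle of length $\operatorname{val}(\mu)$ in $\mathcal Q_\Delta$ that starts at $i$ and runs once around $\mu$. The \emph{Brauer graph algebra} $\mathcal A_\Delta$ is the quotient of the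 path algebra $K\mathcal Q_\Delta$ (paths are written from left to right) by the ideal generated by: $q_{i,\mu}C_{i,\mu}^{m(\mu)}-q_{i,\nu}C_{i,\nu}^{m(\nu)}$ for every edge $i$ with endpoints $\mu,\nu$ and truncated at neither; $C_{i,\nu}^{m(\nu)}b$ for every edge $i$ with endpoints $\mu,\nu$ which is truncated at $\mu$ but not at $\nu$, where $b$ is the first arrow of $C_{i,\nu}$; all paths $ab$ of length two formed by arrows of the first kind such that $ab$ is not a subpath of any $C_{i,\mu}^{m(\mu)}$; and all $x_i^2$. Modules are left modules (not necessarily finite-dimensional), and $\operatorname{Mod}(\mathcal A)$ is the category of $\mathcal A$-modules. \textbf{Coverings.} Let $G$ be a finite abelian group. A \emph{Brauer weighting} $W$ of $\Delta$ with values in $G$ assigns $W(i,j)\in G$ to each (half-)edge $i$ at a vertex $\mu$ with successor $j$ at $\mu$, such that for each $\mu$ the order $\operatorname{ord}(\mu)$ of the product $\omega_\mu$ of all the weights at $\mu$ divides $m(\mu)$. The \emph{quantized Brauer covering graph} $(\Delta_W,\mathfrak o_W,m_W,q_W)$ has edges $i_g$ ($i$ an edge of $\Delta$, $g\in G$). Its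 vertices lying over a vertex $\mu$ of $\Delta$ are the classes $\mu_{[i,H]}$ of pairs $(i,H)$, with $i$ a half-edge at $\mu$ and $H$ a coset of $\langle\omega_\mu\rangle$ in $G$, under the equivalence relation generated by $(i,H)\sim(j,HW(i,j))$ for $j$ the successor of $i$ at $\mu$. The half-edge $i_g$ lies at $\mu_{[i,g\langle\omega_\mu\rangle]}$ and its successor there is $j_{gW(i,j)}$, where $j$ is the successor of $i$ at $\mu$; moreover $m_W(\mu_{[i,H]})=m(\mu)/\operatorname{ord}(\mu)$, and the value of $q_W$ at $i_g$, viewed at $\mu_{[i,H]}$, is $q_{i,\mu}$. Giving an arrow $i\to j$ of $\mathcal Q_\Delta$ the degree $W(i,j)$ and each $x_i$ the degree $1$ makes $\mathcal A_\Delta$ a $G$-graded algebra, and an $\mathcal A_{\Delta_W}$-module $M$ is a $G$-graded $\mathcal A_\Delta$-module on the same space: the idempotent of an edge $i$ acts as $\sum_g e_{i_g}$, an arrow $a$ acts as $\sum_{g}a_g$ (where $a_g$ is the arrow of $\mathcal Q_{\Delta_W}$ over $a$ that starts at $i_g$ if $a$ starts at $i$), and the component of degree $g$ is $\bigoplus_i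 e_{i_{g^{-1}}}M$. The \emph{forgetful functor} $\operatorname{Mod}(\mathcal A_{\Delta_W})\to\operatorname{Mod}(\mathcal A_\Delta)$ sends $M$ to this $\mathcal A_\Delta$-module, forgetting the grading. \textbf{Minimal resolutions.} A projective resolution $\cdots\to P^1\to P^0\to T\to 0$ is \emph{minimal} if every term maps onto the image of its outgoing map by a projective cover, i.e. the kernels of $P^0\to T$ and of all $P^{k+1}\to P^k$ are superfluous submodules (where $N\subseteq M$ is superfluous if $N+L=M$ implies $L=M$ for every submodule $L$). \textbf{Theorem.} Let $n$ be a positive integer and let $(\Delta_0,\mathfrak o_0,m_0,q_0),\dots,(\Delta_n,\mathfrak o_n,m_n,q_n)$ be a tower of quantized Brauer covering graphs, i.e. for $i=1,\dots,n$ there are a finite abelian group $G_i$ and a Brauer weighting $W_i$ of $\Delta_{i-1}$ with values in $G_i$ whose quantized Brauer covering graph is $(\Delta_i,\mathfrak o_i,m_i,q_i)$. Let $\mathcal F_i\colon\operatorname{Mod}(\mathcal A_{\Delta_i})\to\operatorname{Mod}(\mathcal A_{\Delta_{i-1}})$ be the forgetful functors and $\mathcal G=\mathcal F_1\mathcal F_2\cdots\mathcal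 F_n\colon\operatorname{Mod}(\mathcal A_{\Delta_n})\to\operatorname{Mod}(\mathcal A_{\Delta_0})$. Then $\mathcal G$ is exact, and: (i) For every simple $\mathcal A_{\Delta_0}$-module $S$ there is a simple $\mathcal A_{\Delta_n}$-module $T$ with $\mathcal G(T)\cong S$. Moreover, for every such $T$ and every minimal projective $\mathcal A_{\Delta_n}$-resolution $\cdots\to P^2\to P^1\to P^0\to T\to0$, applying $\mathcal G$ gives a minimal projective $\mathcal A_{\Delta_0}$-resolution $\cdots\to \mathcal G(P^2)\to \mathcal G(P^1)\to \mathcal G(P^0)\to \mathcal G(T)\cong S\to0$ of $S$. (ii) If $S'$ is a simple $\mathcal A_{\Delta_n}$-module, then $\mathcal G(S')$ is a simple $\mathcal A_{\Delta_0}$-module. -/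

import Mathlib

open CategoryTheory

universe u v w

set_option linter.unusedSectionVars false

noncomputable section

/-! ### Brauer graphs -/

/-- A finite graph with at least one edge and without isolated vertices, together with a cyclic
ordering of the (half-)edges around every vertex and a positive multiplicity for every vertex.

An element `d : D` is a half-edge; it stands for the edge `edge d`, viewed as incident with the
vertex `vertex d`.  Every edge consists of exactly two half-edges `d` and `flip d`, so the two
endpoints of `edge d` are `vertex d` and `vertex (flip d)`; a loop is an edge both of whose
half-edges lie at the same vertex, so that it is listed twice there.  The cyclic ordering is the
permutation `succ` of half-edges: its cycles are exactly the sets of half-edges lying at a common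
vertex.  Connectedness is not part of the definition. -/
structure BrauerGraph where
  V : Type v
  E : Type v
  D : Type v
  fintypeE : Fintype E
  fintypeD : Fintype D
  nonempty : Nonempty D
  vertex : D → V
  edge : D → E
  vertex_surjective : Function.Surjective vertex
  edge_surjective : Function.Surjective edge
  flip : D → D
  flip_ne : ∀ d, flip d ≠ d
  edge_eq_iff : ∀ d d', edge d = edge d' ↔ d' = d ∨ d' = flip d
  succ : Equiv.Perm D
  vertex_eq_iff : ∀ d d', vertex d = vertex d' ↔ succ.SameCycle d d'
  mult : V → ℕ
  mult_pos : ∀ μ, 0 < mult μ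

/-- A quantized Brauer graph.  Only the values of `q` at half-edges of edges that are truncated at
neither endpoint are ever used. -/
structure QuantizedBrauerGraph (K : Type u) [Field K] extends BrauerGraph.{v} where
  q : D → Kˣ

/-- `walk σ f n d = f d * f (σ d) * ⋯ * f (σ^[n-1] d)`. -/
def walk {D R : Type*} [Monoid R] (σ : D → D) (f : D → R) : ℕ → D → R
  | 0, _ => 1
  | n + 1, d => f d * walk σ f n (σ d)

section Walk

variable {D R S : Type*} [Monoid R] [Monoid S] (σ : D → D) (f : D → R)

lemma walk_add (m n : ℕ) (d : D) :
    walk σ f (m + n) d = walk σ f m d * walk σ f n (σ^[m] d) := by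
  induction m generalizing d with
  | zero => simp [walk]
  | succ m ih => rw [Nat.succ_add, walk, ih, walk, mul_assoc, Function.iterate_succ_apply]

lemma walk_pow {n : ℕ} {d : D} (h : σ^[n] d = d) (m : ℕ) :
    walk σ f n d ^ m = walk σ f (n * m) d := by
  induction m with
  | zero => simp [walk]
  | succ m ih => rw [pow_succ', ih, Nat.mul_succ, add_comm, walk_add, h]

lemma map_walk (φ : R →* S) (n : ℕ) (d : D) :
    φ (walk σ f n d) = walk σ (fun d => φ (f d)) n d := by
  induction n generalizing d with
  | zero => simp [walk]
  | succ n ih => rw [walk, map_mul, ih, walk]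

end Walk

namespace BrauerGraph

attribute [instance] fintypeE fintypeD nonempty

variable (Γ : BrauerGraph.{v})

/-- The valency of a vertex; loops count twice. -/
def val (μ : Γ.V) : ℕ := Nat.card {d : Γ.D // Γ.vertex d = μ}

/-- The edge of the half-edge `d` is truncated at the vertex of `d`. -/
def Truncated (d : Γ.D) : Prop := Γ.val (Γ.vertex d) = 1 ∧ Γ.mult (Γ.vertex d) = 1

/-- The edge `e` is truncated at both of its endpoints (so its connected component is a single edge
with both multiplicities equal to one). -/
def BiTruncated (e : Γ.E) : Prop := ∀ d, Γ.edge d = e → Γ.Truncated d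

/-- Arrows of the quiver: one for each half-edge that is not truncated at its vertex, and one extra
loop for every edge that is truncated at both ends. -/
abbrev Arrow : Type v := {d : Γ.D // ¬ Γ.Truncated d} ⊕ {e : Γ.E // Γ.BiTruncated e}

/-- The source of an arrow. -/
def source : Γ.Arrow → Γ.E := Sum.elim (fun d => Γ.edge d.1) (fun e => e.1)

/-- The target of an arrow. -/
def target : Γ.Arrow → Γ.E := Sum.elim (fun d => Γ.edge (Γ.succ d.1)) (fun e => e.1)

end BrauerGraph

/-! ### Path algebras -/

section PathAlgebra

variable (K : Type u) [Field K] {V A : Type*} [Fintype V] (s t : A → V)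

/-- The defining relations of the path algebra of the quiver with vertices `V`, arrows `A`, source
map `s` and target map `t`: the vertices are orthogonal idempotents with sum one, and every arrow
`a` satisfies `s(a) a = a = a t(a)` (paths are written from left to right). -/
inductive PathRel : FreeAlgebra K (V ⊕ A) → FreeAlgebra K (V ⊕ A) → Prop
  | sum : PathRel (∑ v : V, FreeAlgebra.ι K (Sum.inl v)) 1
  | idem (v : V) : PathRel (FreeAlgebra.ι K (Sum.inl v) * FreeAlgebra.ι K (Sum.inl v))
      (FreeAlgebra.ι K (Sum.inl v))
  | orth (v w : V) : v ≠ w →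
      PathRel (FreeAlgebra.ι K (Sum.inl v) * FreeAlgebra.ι K (Sum.inl w)) 0
  | src (a : A) : PathRel (FreeAlgebra.ι K (Sum.inl (s a)) * FreeAlgebra.ι K (Sum.inr a))
      (FreeAlgebra.ι K (Sum.inr a))
  | tgt (a : A) : PathRel (FreeAlgebra.ι K (Sum.inr a) * FreeAlgebra.ι K (Sum.inl (t a)))
      (FreeAlgebra.ι K (Sum.inr a))

/-- The path algebra of a quiver with finitely many vertices. -/
abbrev PathAlgebra : Type _ := RingQuot (PathRel K s t)

/-- The idempotent of a vertex. -/
def PathAlgebra.vert (v : V) : PathAlgebra K s t :=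
  RingQuot.mkAlgHom K (PathRel K s t) (FreeAlgebra.ι K (Sum.inl v))

/-- The element of an arrow. -/
def PathAlgebra.arr (a : A) : PathAlgebra K s t :=
  RingQuot.mkAlgHom K (PathRel K s t) (FreeAlgebra.ι K (Sum.inr a))

end PathAlgebra

/-! ### Brauer graph algebras -/

namespace QuantizedBrauerGraph

variable {K : Type u} [Field K] (Γ : QuantizedBrauerGraph.{u, v} K)

/-- The path algebra of the quiver of `Γ`. -/
abbrev KQ : Type (max u v) := PathAlgebra K Γ.source Γ.target

open Classical in
/-- The arrow from the edge of `d` to the edge of its successor at the vertex of `d`; by convention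
it is `0` if `d` is truncated. -/
def qArr (d : Γ.D) : Γ.KQ :=
  if h : Γ.Truncated d then 0 else PathAlgebra.arr K Γ.source Γ.target (Sum.inl ⟨d, h⟩)

/-- The cycle `C_{i,μ}` at the edge of `d` around the vertex of `d`. -/
def cyc (d : Γ.D) : Γ.KQ := walk Γ.succ Γ.qArr (Γ.val (Γ.vertex d)) d

/-- The Brauer graph relations.  In type three, a composable pair of arrows `d`, `d'` occurs in a
power of a cycle around a vertex exactly when `d'` is the successor of `d`. -/
inductive BrauerRel : Γ.KQ → Γ.KQ → Prop
  | one (d : Γ.D) : ¬ Γ.Truncated d → ¬ Γ.Truncated (Γ.flip d) →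
      BrauerRel ((Γ.q d : K) • Γ.cyc d ^ Γ.mult (Γ.vertex d))
        ((Γ.q (Γ.flip d) : K) • Γ.cyc (Γ.flip d) ^ Γ.mult (Γ.vertex (Γ.flip d)))
  | two (d : Γ.D) : Γ.Truncated (Γ.flip d) → ¬ Γ.Truncated d →
      BrauerRel (Γ.cyc d ^ Γ.mult (Γ.vertex d) * Γ.qArr d) 0
  | three (d d' : Γ.D) : ¬ Γ.Truncated d → ¬ Γ.Truncated d' →
      Γ.edge (Γ.succ d) = Γ.edge d' → d' ≠ Γ.succ d → BrauerRel (Γ.qArr d * Γ.qArr d') 0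
  | loop (e : {e : Γ.E // Γ.BiTruncated e}) :
      BrauerRel (PathAlgebra.arr K Γ.source Γ.target (Sum.inr e) *
        PathAlgebra.arr K Γ.source Γ.target (Sum.inr e)) 0

/-- The Brauer graph algebra: the quotient of the path algebra by the two-sided ideal generated by
the Brauer graph relations. -/
abbrev Alg : Type (max u v) := RingQuot Γ.BrauerRel

/-- The idempotent of `Γ.Alg` given by an edge of `Γ`. -/
def e (i : Γ.E) : Γ.Alg :=
  RingQuot.mkAlgHom K Γ.BrauerRel (PathAlgebra.vert K Γ.source Γ.target i)

/-- The image of `qArr d` in `Γ.Alg`. -/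
def a (d : Γ.D) : Γ.Alg := RingQuot.mkAlgHom K Γ.BrauerRel (Γ.qArr d)

open Classical in
/-- The extra loop at an edge truncated at both ends; `0` by convention at any other edge. -/
def x (i : Γ.E) : Γ.Alg :=
  if h : Γ.BiTruncated i then
    RingQuot.mkAlgHom K Γ.BrauerRel (PathAlgebra.arr K Γ.source Γ.target (Sum.inr ⟨i, h⟩)) else 0

end QuantizedBrauerGraph

/-! ### Weightings and coverings -/

namespace BrauerGraph

variable (Γ : BrauerGraph.{v}) {G : Type v} [CommGroup G] [Fintype G]

open Classical in
/-- The product of the weights of all pairs (half-edge, successor) at a vertex. -/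
def omega (W : Γ.D → G) (μ : Γ.V) : G := ∏ d with Γ.vertex d = μ, W d

variable (G) in
/-- A Brauer weighting: `weight d` is the weight of the pair (edge of `d`, successor of `d`) at the
vertex of `d`, and the order of every vertex divides its multiplicity. -/
structure Weighting where
  weight : Γ.D → G
  order_dvd : ∀ μ, orderOf (Γ.omega weight μ) ∣ Γ.mult μ

section Cycles

open Finset

lemma vertex_succ (d : Γ.D) : Γ.vertex (Γ.succ d) = Γ.vertex d :=
  ((Γ.vertex_eq_iff _ _).2 ⟨1, by simp⟩).symm

lemma edge_flip (d : Γ.D) : Γ.edge (Γ.flip d) = Γ.edge d :=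
  ((Γ.edge_eq_iff _ _).2 (Or.inr rfl)).symm

lemma flip_flip (d : Γ.D) : Γ.flip (Γ.flip d) = d := by
  rcases (Γ.edge_eq_iff _ _).1 (Γ.edge_flip d) with h | h
  · exact absurd h.symm (Γ.flip_ne d)
  · exact h.symm

lemma vertex_pow (d : Γ.D) (n : ℕ) : Γ.vertex ((Γ.succ ^ n) d) = Γ.vertex d := by
  refine ((Γ.vertex_eq_iff _ _).2 ⟨n, by simp⟩).symm

open Classical in
lemma isCycleOn (μ : Γ.V) : Γ.succ.IsCycleOn ((univ.filter fun d => Γ.vertex d = μ : Finset Γ.D) :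
    Set Γ.D) := by
  refine ⟨⟨?_, Γ.succ.injective.injOn, ?_⟩, ?_⟩
  · intro d hd
    simpa [vertex_succ] using hd
  · intro d hd
    refine ⟨Γ.succ.symm d, ?_, by simp⟩
    have := Γ.vertex_succ (Γ.succ.symm d)
    simp only [Equiv.apply_symm_apply] at this
    simpa [← this] using hd
  · intro d hd d' hd'
    have hd : Γ.vertex d = μ := by simpa using hd
    have hd' : Γ.vertex d' = μ := by simpa using hd'
    exact (Γ.vertex_eq_iff _ _).1 (hd.trans hd'.symm)

open Classical in
lemma card_filter (μ : Γ.V) : (univ.filter fun d => Γ.vertex d = μ : Finset Γ.D).card = Γ.val μ := by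
  rw [val, Nat.card_eq_fintype_card, Fintype.card_subtype]

lemma pow_eq_iff (d : Γ.D) (n : ℕ) : (Γ.succ ^ n) d = d ↔ Γ.val (Γ.vertex d) ∣ n := by
  classical
  rw [← card_filter]
  exact (Γ.isCycleOn (Γ.vertex d)).pow_apply_eq (by simp)

lemma pow_val_mul (d : Γ.D) (n : ℕ) : (Γ.succ ^ (Γ.val (Γ.vertex d) * n)) d = d :=
  (Γ.pow_eq_iff d _).2 (dvd_mul_right _ _)

lemma val_pos (μ : Γ.V) : 0 < Γ.val μ := by
  obtain ⟨d, rfl⟩ := Γ.vertex_surjective μ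
  exact Nat.card_pos_iff.2 ⟨⟨⟨d, rfl⟩⟩, inferInstance⟩

lemma truncated_iff (d : Γ.D) :
    Γ.Truncated d ↔ Γ.val (Γ.vertex d) * Γ.mult (Γ.vertex d) = 1 := by
  simp [Truncated]

lemma truncated_succ (d : Γ.D) : Γ.Truncated (Γ.succ d) ↔ Γ.Truncated d := by
  rw [Truncated, Truncated, vertex_succ]

lemma prod_val (W : Γ.D → G) (d : Γ.D) :
    ∏ k ∈ range (Γ.val (Γ.vertex d)), W ((Γ.succ ^ k) d) = Γ.omega W (Γ.vertex d) := by
  classical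
  have hc := Γ.isCycleOn (Γ.vertex d)
  have hd : d ∈ (univ.filter fun d' => Γ.vertex d' = Γ.vertex d : Finset Γ.D) := by simp
  rw [omega, ← card_filter]
  refine prod_bij (fun k _ => (Γ.succ ^ k) d) ?_ ?_ ?_ ?_
  · intro k _
    simp [vertex_pow]
  · intro k hk l hl h
    have := (hc.pow_apply_eq_pow_apply hd).1 h
    exact Nat.ModEq.eq_of_lt_of_lt this (by simpa using hk) (by simpa using hl)
  · intro b hb
    obtain ⟨k, hk, rfl⟩ := hc.exists_pow_eq hd hb
    exact ⟨k, by simpa using hk, rfl⟩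
  · intros
    rfl

lemma prod_val_mul (W : Γ.D → G) (d : Γ.D) (n : ℕ) :
    ∏ k ∈ range (Γ.val (Γ.vertex d) * n), W ((Γ.succ ^ k) d) = Γ.omega W (Γ.vertex d) ^ n := by
  induction n with
  | zero => simp
  | succ n ih =>
    rw [Nat.mul_succ, prod_range_add, ih, pow_succ, ← prod_val]
    congr 1
    refine prod_congr rfl fun k _ => ?_
    rw [add_comm, pow_add, Equiv.Perm.mul_apply, pow_val_mul]

end Cycles

variable {Γ}

namespace Weighting

variable (W : Γ.Weighting G)

/-- Pairs `(i, H)`, where `i` is a half-edge at a vertex `μ` and `H` is a coset of the subgroup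
generated by `omega μ`. -/
abbrev Pair : Type v := Σ d : Γ.D, G ⧸ Subgroup.zpowers (Γ.omega W.weight (Γ.vertex d))

/-- The generating relation `(i, H) ∼ (j, H W(i,j))`, for `j` the successor of `i`. -/
inductive Step : W.Pair → W.Pair → Prop
  | mk (d : Γ.D) (g : G) : Step ⟨d, QuotientGroup.mk g⟩
      ⟨Γ.succ d, QuotientGroup.mk (g * W.weight d)⟩

/-- The vertices `μ_[i,H]` of the covering graph. -/
def CoverV : Type v := Quot W.Step

/-- The vertex of the half-edge `d_g` in the covering graph. -/
def coverVertex (p : Γ.D × G) : W.CoverV := Quot.mk _ ⟨p.1, QuotientGroup.mk p.2⟩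

/-- The vertex `μ` below `μ_[i,H]`. -/
def baseVertex : W.CoverV → Γ.V :=
  Quot.lift (fun p => Γ.vertex p.1) (by
    rintro _ _ ⟨d, g⟩
    exact (Γ.vertex_eq_iff _ _).2 ⟨1, by simp⟩)

/-- In the covering graph, the successor of `i_g` is `j_{g W(i,j)}`. -/
def coverSucc : Equiv.Perm (Γ.D × G) where
  toFun p := (Γ.succ p.1, p.2 * W.weight p.1)
  invFun p := (Γ.succ.symm p.1, p.2 * (W.weight (Γ.succ.symm p.1))⁻¹)
  left_inv p := by simp
  right_inv p := by simp

open Finset in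
lemma coverSucc_pow (n : ℕ) (d : Γ.D) (g : G) :
    (W.coverSucc ^ n) (d, g) =
      ((Γ.succ ^ n) d, g * ∏ k ∈ range n, W.weight ((Γ.succ ^ k) d)) := by
  induction n with
  | zero => simp
  | succ n ih =>
    rw [pow_succ', Equiv.Perm.mul_apply, ih, prod_range_succ, pow_succ' Γ.succ]
    simp [coverSucc, mul_assoc]

lemma coverVertex_succ (p : Γ.D × G) : W.coverVertex (W.coverSucc p) = W.coverVertex p :=
  (Quot.sound (Step.mk p.1 p.2)).symm

/-- The cycle of `coverSucc` determined by a pair `(i, H)`. -/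
def cycleOf (p : W.Pair) : Quotient (Equiv.Perm.SameCycle.setoid W.coverSucc) :=
  Quotient.lift (s := QuotientGroup.leftRel (Subgroup.zpowers (Γ.omega W.weight (Γ.vertex p.1))))
    (fun g => Quotient.mk _ (p.1, g)) (by
      intro g h hgh
      have hgh := QuotientGroup.leftRel_apply.1 hgh
      obtain ⟨n, hn⟩ := (mem_powers_iff_mem_zpowers).2 hgh
      refine Quotient.sound ⟨(Γ.val (Γ.vertex p.1) * n : ℕ), ?_⟩
      rw [zpow_natCast, coverSucc_pow, Γ.pow_val_mul, Γ.prod_val_mul]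
      simp only at hn
      rw [hn]
      simp) p.2

lemma coverVertex_eq_iff (p p' : Γ.D × G) :
    W.coverVertex p = W.coverVertex p' ↔ W.coverSucc.SameCycle p p' := by
  constructor
  · intro h
    let F : W.CoverV → Quotient (Equiv.Perm.SameCycle.setoid W.coverSucc) :=
      Quot.lift W.cycleOf (by
        rintro _ _ ⟨d, g⟩
        exact Quotient.sound ⟨1, by simp [coverSucc]⟩)
    exact Quotient.exact (congrArg F h)
  · intro h
    obtain ⟨n, rfl⟩ := h.exists_nat_pow_eq
    clear h
    induction n with
    | zero => rfl
    | succ n ih => rw [ih, pow_succ', Equiv.Perm.mul_apply, coverVertex_succ]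

/-- The Brauer covering graph. -/
def coverGraph : BrauerGraph.{v} where
  V := W.CoverV
  E := Γ.E × G
  D := Γ.D × G
  fintypeE := inferInstance
  fintypeD := inferInstance
  nonempty := inferInstance
  vertex := W.coverVertex
  edge p := (Γ.edge p.1, p.2)
  vertex_surjective := by
    rintro ⟨⟨d, c⟩⟩
    obtain ⟨g, rfl⟩ := QuotientGroup.mk_surjective c
    exact ⟨(d, g), rfl⟩
  edge_surjective := by
    rintro ⟨i, g⟩
    obtain ⟨d, rfl⟩ := Γ.edge_surjective i
    exact ⟨(d, g), rfl⟩
  flip p := (Γ.flip p.1, p.2)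
  flip_ne p h := Γ.flip_ne p.1 (congrArg Prod.fst h)
  edge_eq_iff := by
    rintro ⟨d, g⟩ ⟨d', g'⟩
    simp only [Prod.mk.injEq, Γ.edge_eq_iff]
    tauto
  succ := W.coverSucc
  vertex_eq_iff := W.coverVertex_eq_iff
  mult μ := Γ.mult (W.baseVertex μ) / orderOf (Γ.omega W.weight (W.baseVertex μ))
  mult_pos μ := Nat.div_pos (Nat.le_of_dvd (Γ.mult_pos _) (W.order_dvd _)) (orderOf_pos _)

/-- The half-edge `d_g` of the covering graph. -/
def half (d : Γ.D) (g : G) : W.coverGraph.D := (d, g)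

/-- The edge `i_g` of the covering graph. -/
def edgeAt (i : Γ.E) (g : G) : W.coverGraph.E := (i, g)

lemma val_coverGraph (d : Γ.D) (g : G) :
    W.coverGraph.val (W.coverGraph.vertex (W.half d g)) =
      Γ.val (Γ.vertex d) * orderOf (Γ.omega W.weight (Γ.vertex d)) := by
  have key : ∀ n, W.coverGraph.val (W.coverGraph.vertex (W.half d g)) ∣ n ↔
      Γ.val (Γ.vertex d) * orderOf (Γ.omega W.weight (Γ.vertex d)) ∣ n := by
    intro n
    rw [← BrauerGraph.pow_eq_iff]
    change (W.coverSucc ^ n) (d, g) = (d, g) ↔ _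
    rw [coverSucc_pow, Prod.mk.injEq, Γ.pow_eq_iff]
    constructor
    · rintro ⟨⟨t, rfl⟩, h⟩
      rw [Γ.prod_val_mul, mul_eq_left] at h
      exact Nat.mul_dvd_mul_left _ (orderOf_dvd_of_pow_eq_one h)
    · intro h
      obtain ⟨t, rfl⟩ := h
      rw [mul_assoc]
      refine ⟨dvd_mul_right _ _, ?_⟩
      rw [Γ.prod_val_mul, pow_mul, pow_orderOf_eq_one, one_pow, mul_one]
  exact Nat.dvd_antisymm ((key _).2 dvd_rfl) ((key _).1 dvd_rfl)

lemma val_mul_mult (d : Γ.D) (g : G) :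
    W.coverGraph.val (W.coverGraph.vertex (W.half d g)) * W.coverGraph.mult (W.coverGraph.vertex (W.half d g)) =
      Γ.val (Γ.vertex d) * Γ.mult (Γ.vertex d) := by
  rw [val_coverGraph, mul_assoc]
  congr 1
  exact Nat.mul_div_cancel' (W.order_dvd (Γ.vertex d))

lemma truncated_coverGraph (d : Γ.D) (g : G) :
    W.coverGraph.Truncated (W.half d g) ↔ Γ.Truncated d := by
  rw [BrauerGraph.truncated_iff, BrauerGraph.truncated_iff, val_mul_mult]

lemma biTruncated_coverGraph (i : Γ.E) (g : G) :
    W.coverGraph.BiTruncated (W.edgeAt i g) ↔ Γ.BiTruncated i := by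
  constructor
  · intro h d hd
    exact (W.truncated_coverGraph d g).1 (h (W.half d g) (congrArg (·, g) hd))
  · rintro h ⟨d, g'⟩ hd
    exact (W.truncated_coverGraph d g').2 (h d (congrArg Prod.fst hd))

end Weighting

end BrauerGraph


/-! ### The covering homomorphism -/

namespace QuantizedBrauerGraph

variable {K : Type u} [Field K]

section Relations

variable (Γ : QuantizedBrauerGraph.{u, v} K)

lemma e_sum : ∑ i, Γ.e i = 1 := by
  simp only [e, PathAlgebra.vert, ← map_sum]
  rw [RingQuot.mkAlgHom_rel K PathRel.sum, map_one, map_one]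

lemma e_mul_self (i : Γ.E) : Γ.e i * Γ.e i = Γ.e i := by
  simp only [e, PathAlgebra.vert, ← map_mul]
  rw [RingQuot.mkAlgHom_rel K (PathRel.idem i)]

lemma e_mul_of_ne {i j : Γ.E} (h : i ≠ j) : Γ.e i * Γ.e j = 0 := by
  simp only [e, PathAlgebra.vert, ← map_mul]
  rw [RingQuot.mkAlgHom_rel K (PathRel.orth i j h), map_zero, map_zero]

lemma a_of_truncated {d : Γ.D} (h : Γ.Truncated d) : Γ.a d = 0 := by
  simp [a, qArr, h]

lemma x_of_not {i : Γ.E} (h : ¬ Γ.BiTruncated i) : Γ.x i = 0 := by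
  simp [x, h]

lemma e_mul_a (d : Γ.D) : Γ.e (Γ.edge d) * Γ.a d = Γ.a d := by
  by_cases h : Γ.Truncated d
  · simp [Γ.a_of_truncated h]
  · simp only [a, e, qArr, h, dite_false, PathAlgebra.vert, PathAlgebra.arr, ← map_mul]
    congr 1
    exact RingQuot.mkAlgHom_rel K (PathRel.src (s := Γ.source) (t := Γ.target) (Sum.inl ⟨d, h⟩))

lemma a_mul_e (d : Γ.D) : Γ.a d * Γ.e (Γ.edge (Γ.succ d)) = Γ.a d := by
  by_cases h : Γ.Truncated d
  · simp [Γ.a_of_truncated h]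
  · simp only [a, e, qArr, h, dite_false, PathAlgebra.vert, PathAlgebra.arr, ← map_mul]
    congr 1
    exact RingQuot.mkAlgHom_rel K (PathRel.tgt (s := Γ.source) (t := Γ.target) (Sum.inl ⟨d, h⟩))

lemma e_mul_x (i : Γ.E) : Γ.e i * Γ.x i = Γ.x i := by
  by_cases h : Γ.BiTruncated i
  · simp only [x, e, h, dite_true, PathAlgebra.vert, PathAlgebra.arr, ← map_mul]
    congr 1
    exact RingQuot.mkAlgHom_rel K (PathRel.src (s := Γ.source) (t := Γ.target) (Sum.inr ⟨i, h⟩))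
  · simp [Γ.x_of_not h]

lemma x_mul_e (i : Γ.E) : Γ.x i * Γ.e i = Γ.x i := by
  by_cases h : Γ.BiTruncated i
  · simp only [x, e, h, dite_true, PathAlgebra.vert, PathAlgebra.arr, ← map_mul]
    congr 1
    exact RingQuot.mkAlgHom_rel K (PathRel.tgt (s := Γ.source) (t := Γ.target) (Sum.inr ⟨i, h⟩))
  · simp [Γ.x_of_not h]

lemma x_mul_self (i : Γ.E) : Γ.x i * Γ.x i = 0 := by
  by_cases h : Γ.BiTruncated i
  · simp only [x, h, dite_true, ← map_mul]
    rw [RingQuot.mkAlgHom_rel K (BrauerRel.loop ⟨i, h⟩), map_zero]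
  · simp [Γ.x_of_not h]

lemma cyc_pow (d : Γ.D) (m : ℕ) :
    Γ.cyc d ^ m = walk Γ.succ Γ.qArr (Γ.val (Γ.vertex d) * m) d := by
  refine walk_pow _ _ ?_ m
  have := Γ.pow_val_mul d 1
  rwa [mul_one, Equiv.Perm.coe_pow] at this

lemma mk_cyc_pow (d : Γ.D) (m : ℕ) : RingQuot.mkAlgHom K Γ.BrauerRel (Γ.cyc d ^ m) =
    walk Γ.succ Γ.a (Γ.val (Γ.vertex d) * m) d := by
  rw [cyc_pow]
  exact map_walk _ _ (RingQuot.mkAlgHom K Γ.BrauerRel : Γ.KQ →* Γ.Alg) _ _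

lemma rel_one (d : Γ.D) (h : ¬ Γ.Truncated d) (h' : ¬ Γ.Truncated (Γ.flip d)) :
    (Γ.q d : K) • walk Γ.succ Γ.a (Γ.val (Γ.vertex d) * Γ.mult (Γ.vertex d)) d =
      (Γ.q (Γ.flip d) : K) • walk Γ.succ Γ.a
        (Γ.val (Γ.vertex (Γ.flip d)) * Γ.mult (Γ.vertex (Γ.flip d))) (Γ.flip d) := by
  rw [← mk_cyc_pow, ← mk_cyc_pow, ← map_smul, ← map_smul]
  exact RingQuot.mkAlgHom_rel K (BrauerRel.one d h h')

lemma rel_two (d : Γ.D) (h : Γ.Truncated (Γ.flip d)) (h' : ¬ Γ.Truncated d) :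
    walk Γ.succ Γ.a (Γ.val (Γ.vertex d) * Γ.mult (Γ.vertex d)) d * Γ.a d = 0 := by
  rw [← mk_cyc_pow, a, ← map_mul, RingQuot.mkAlgHom_rel K (BrauerRel.two d h h'), map_zero]

lemma rel_three (d d' : Γ.D) (h : d' ≠ Γ.succ d) : Γ.a d * Γ.a d' = 0 := by
  by_cases ht : Γ.Truncated d
  · simp [Γ.a_of_truncated ht]
  by_cases ht' : Γ.Truncated d'
  · simp [Γ.a_of_truncated ht']
  by_cases he : Γ.edge (Γ.succ d) = Γ.edge d'
  · rw [a, a, ← map_mul, RingQuot.mkAlgHom_rel K (BrauerRel.three d d' ht ht' he h), map_zero]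
  · rw [← a_mul_e, ← Γ.e_mul_a d', mul_assoc, ← mul_assoc (Γ.e _), Γ.e_mul_of_ne he, zero_mul,
      mul_zero]

end Relations

variable {Γ : QuantizedBrauerGraph.{u, v} K} {G : Type v} [CommGroup G] [Fintype G]
  (W : Γ.toBrauerGraph.Weighting G)

/-- The quantized Brauer covering graph. -/
def cover : QuantizedBrauerGraph.{u, v} K where
  toBrauerGraph := W.coverGraph
  q p := Γ.q p.1

/-- The half-edge `d_g` of the covering graph. -/
def half (d : Γ.D) (g : G) : (cover W).D := (d, g)

/-- The edge `i_g` of the covering graph. -/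
def edgeAt (i : Γ.E) (g : G) : (cover W).E := (i, g)

lemma truncated_half (d : Γ.D) (g : G) : (cover W).Truncated (half W d g) ↔ Γ.Truncated d :=
  W.truncated_coverGraph d g

lemma biTruncated_edgeAt (i : Γ.E) (g : G) :
    (cover W).BiTruncated (edgeAt W i g) ↔ Γ.BiTruncated i :=
  W.biTruncated_coverGraph i g

lemma succ_half (d : Γ.D) (g : G) :
    (cover W).succ (half W d g) = half W (Γ.succ d) (g * W.weight d) := rfl

lemma edge_half (d : Γ.D) (g : G) : (cover W).edge (half W d g) = edgeAt W (Γ.edge d) g := rfl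

lemma flip_half (d : Γ.D) (g : G) : (cover W).flip (half W d g) = half W (Γ.flip d) g := rfl

lemma edgeAt_inj {i j : Γ.E} {g h : G} : edgeAt W i g = edgeAt W j h ↔ i = j ∧ g = h :=
  Prod.mk_inj

lemma e_edgeAt_mul_ne (i j : Γ.E) (g h : G) (hne : i ≠ j ∨ g ≠ h) :
    (cover W).e (edgeAt W i g) * (cover W).e (edgeAt W j h) = 0 := by
  refine (cover W).e_mul_of_ne fun H => ?_
  rw [edgeAt_inj] at H
  tauto

/-- The image `∑ g, e(i_g)` of the idempotent of the edge `i`. -/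
def eSum (i : Γ.E) : (cover W).Alg := ∑ g : G, (cover W).e (edgeAt W i g)

/-- The image `∑ g, a_g` of an arrow `a`. -/
def aSum (d : Γ.D) : (cover W).Alg := ∑ g : G, (cover W).a (half W d g)

/-- The image of the extra loop of an edge truncated at both ends. -/
def xSum (i : Γ.E) : (cover W).Alg := ∑ g : G, (cover W).x (edgeAt W i g)

lemma eSum_mul (i : Γ.E) (g : G) (y : (cover W).Alg)
    (hy : (cover W).e (edgeAt W i g) * y = y) : eSum W i * y = y := by
  rw [eSum, ← hy, ← mul_assoc, Finset.sum_mul, Finset.sum_eq_single g]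
  · rw [e_mul_self]
  · intro h _ hne
    exact e_edgeAt_mul_ne W i i h g (Or.inr hne)
  · simp

lemma mul_eSum (i : Γ.E) (g : G) (y : (cover W).Alg)
    (hy : y * (cover W).e (edgeAt W i g) = y) : y * eSum W i = y := by
  rw [eSum, ← hy, mul_assoc, Finset.mul_sum, Finset.sum_eq_single g]
  · rw [e_mul_self]
  · intro h _ hne
    exact e_edgeAt_mul_ne W i i g h (Or.inr hne.symm)
  · simp

lemma eSum_sum : ∑ i, eSum W i = 1 := by
  rw [← (cover W).e_sum]
  exact (Fintype.sum_prod_type (fun p : Γ.E × G => (cover W).e p)).symm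

lemma eSum_mul_self (i : Γ.E) : eSum W i * eSum W i = eSum W i := by
  nth_rw 2 [eSum]
  rw [Finset.mul_sum]
  exact Finset.sum_congr rfl fun g _ => eSum_mul W i g _ ((cover W).e_mul_self _)

lemma eSum_mul_of_ne {i j : Γ.E} (h : i ≠ j) : eSum W i * eSum W j = 0 := by
  rw [eSum, eSum, Finset.sum_mul_sum]
  exact Finset.sum_eq_zero fun g _ => Finset.sum_eq_zero fun g' _ =>
    e_edgeAt_mul_ne W i j g g' (Or.inl h)

lemma eSum_mul_aSum (d : Γ.D) : eSum W (Γ.edge d) * aSum W d = aSum W d := by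
  rw [aSum, Finset.mul_sum]
  exact Finset.sum_congr rfl fun g _ => eSum_mul W _ g _ ((cover W).e_mul_a (half W d g))

lemma aSum_mul_eSum (d : Γ.D) : aSum W d * eSum W (Γ.edge (Γ.succ d)) = aSum W d := by
  rw [aSum, Finset.sum_mul]
  exact Finset.sum_congr rfl fun g _ =>
    mul_eSum W _ (g * W.weight d) _ ((cover W).a_mul_e (half W d g))

lemma eSum_mul_xSum (i : Γ.E) : eSum W i * xSum W i = xSum W i := by
  rw [xSum, Finset.mul_sum]
  exact Finset.sum_congr rfl fun g _ => eSum_mul W _ g _ ((cover W).e_mul_x (edgeAt W i g))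

lemma xSum_mul_eSum (i : Γ.E) : xSum W i * eSum W i = xSum W i := by
  rw [xSum, Finset.sum_mul]
  exact Finset.sum_congr rfl fun g _ => mul_eSum W _ g _ ((cover W).x_mul_e (edgeAt W i g))

lemma xSum_mul_self (i : Γ.E) : xSum W i * xSum W i = 0 := by
  rw [xSum, Finset.sum_mul_sum]
  refine Finset.sum_eq_zero fun g _ => Finset.sum_eq_zero fun g' _ => ?_
  by_cases h : g = g'
  · rw [h, x_mul_self]
  · rw [← x_mul_e, ← (cover W).e_mul_x (edgeAt W i g'), mul_assoc, ← mul_assoc ((cover W).e _),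
      e_edgeAt_mul_ne W i i g g' (Or.inr h), zero_mul, mul_zero]

lemma aSum_mul_of_ne (d d' : Γ.D) (h : d' ≠ Γ.succ d) : aSum W d * aSum W d' = 0 := by
  rw [aSum, aSum, Finset.sum_mul_sum]
  exact Finset.sum_eq_zero fun g _ => Finset.sum_eq_zero fun g' _ =>
    (cover W).rel_three _ _ fun H => h (congrArg Prod.fst H)

lemma eSum_mul_walk (n : ℕ) (d : Γ.D) :
    eSum W (Γ.edge d) * walk Γ.succ (aSum W) n d =
      ∑ g, (cover W).e (edgeAt W (Γ.edge d) g) *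
        walk (cover W).succ (cover W).a n (half W d g) := by
  induction n generalizing d with
  | zero => simp [walk, eSum]
  | succ n ih =>
    rw [walk, ← mul_assoc, eSum_mul_aSum, ← aSum_mul_eSum, mul_assoc, ih, aSum, Finset.sum_mul_sum]
    refine Finset.sum_congr rfl fun g _ => ?_
    rw [Finset.sum_eq_single (g * W.weight d), walk, succ_half, ← mul_assoc, ← mul_assoc]
    · congr 1
      have h1 := (cover W).a_mul_e (half W d g)
      have h2 := (cover W).e_mul_a (half W d g)
      rw [succ_half, edge_half] at h1
      rw [edge_half] at h2
      rw [h1, h2]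
    · intro h _ hne
      rw [← (cover W).a_mul_e (half W d g), mul_assoc, ← mul_assoc ((cover W).e _), succ_half,
        edge_half, e_edgeAt_mul_ne W _ _ _ _ (Or.inr hne.symm), zero_mul, mul_zero]
    · simp

lemma walk_aSum {n : ℕ} (hn : 0 < n) (d : Γ.D) :
    walk Γ.succ (aSum W) n d = ∑ g, walk (cover W).succ (cover W).a n (half W d g) := by
  have h := eSum_mul_walk W n d
  obtain ⟨n, rfl⟩ := Nat.exists_eq_succ_of_ne_zero hn.ne'
  simp only [walk, ← mul_assoc, eSum_mul_aSum] at h ⊢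
  rw [h]
  refine Finset.sum_congr rfl fun g _ => ?_
  rw [← edge_half, e_mul_a]

/-- The values of the covering homomorphism on vertices and arrows of the quiver. -/
def coverFun : Γ.E ⊕ Γ.Arrow → (cover W).Alg
  | Sum.inl i => eSum W i
  | Sum.inr (Sum.inl d) => aSum W d.1
  | Sum.inr (Sum.inr i) => xSum W i.1

/-- The covering homomorphism on path algebras, with values in the algebra of the covering. -/
def coverHomKQ : Γ.KQ →ₐ[K] (cover W).Alg :=
  RingQuot.liftAlgHom K ⟨FreeAlgebra.lift K (coverFun W), by
    rintro _ _ (_ | i | ⟨i, j, h⟩ | (d | i) | (d | i))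
    · simpa [coverFun, BrauerGraph.source, BrauerGraph.target] using eSum_sum W
    · simpa [coverFun, BrauerGraph.source, BrauerGraph.target] using eSum_mul_self W i
    · simpa [coverFun, BrauerGraph.source, BrauerGraph.target] using eSum_mul_of_ne W h
    · simpa [coverFun, BrauerGraph.source, BrauerGraph.target] using eSum_mul_aSum W d.1
    · simpa [coverFun, BrauerGraph.source, BrauerGraph.target] using eSum_mul_xSum W i.1
    · simpa [coverFun, BrauerGraph.source, BrauerGraph.target] using aSum_mul_eSum W d.1
    · simpa [coverFun, BrauerGraph.source, BrauerGraph.target] using xSum_mul_eSum W i.1⟩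

lemma coverHomKQ_vert (i : Γ.E) :
    coverHomKQ W (PathAlgebra.vert K Γ.source Γ.target i) = eSum W i := by
  simp [coverFun, coverHomKQ, PathAlgebra.vert]

lemma coverHomKQ_loop (i : {e : Γ.E // Γ.BiTruncated e}) :
    coverHomKQ W (PathAlgebra.arr K Γ.source Γ.target (Sum.inr i)) = xSum W i.1 := by
  simp [coverFun, coverHomKQ, PathAlgebra.arr]

lemma coverHomKQ_qArr (d : Γ.D) : coverHomKQ W (Γ.qArr d) = aSum W d := by
  by_cases h : Γ.Truncated d
  · rw [qArr, dif_pos h, map_zero, aSum]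
    exact (Finset.sum_eq_zero fun g _ =>
      (cover W).a_of_truncated ((truncated_half W d g).2 h)).symm
  · simp [coverFun, coverHomKQ, PathAlgebra.arr, qArr, h]

lemma coverHomKQ_cyc_pow_eq (d : Γ.D) (m : ℕ) : coverHomKQ W (Γ.cyc d ^ m) =
    walk Γ.succ (aSum W) (Γ.val (Γ.vertex d) * m) d := by
  rw [cyc_pow]
  refine (map_walk _ _ (coverHomKQ W : Γ.KQ →* (cover W).Alg) _ _).trans ?_
  congr 1
  exact funext fun d => coverHomKQ_qArr W d

lemma walk_mul_a (Γ : QuantizedBrauerGraph.{u, v} K) {R : Type*} [Monoid R] (f : Γ.D → R) (d : Γ.D)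
    (m : ℕ) : walk Γ.succ f (Γ.val (Γ.vertex d) * m) d * f d =
      walk Γ.succ f (Γ.val (Γ.vertex d) * m + 1) d := by
  rw [walk_add, ← Equiv.Perm.coe_pow, Γ.pow_val_mul]
  simp [walk]

lemma coverHomKQ_cyc_pow (d : Γ.D) :
    coverHomKQ W (Γ.cyc d ^ Γ.mult (Γ.vertex d)) = ∑ g, walk (cover W).succ (cover W).a
      ((cover W).val ((cover W).vertex (half W d g)) *
        (cover W).mult ((cover W).vertex (half W d g))) (half W d g) := by
  rw [coverHomKQ_cyc_pow_eq, walk_aSum W (Nat.mul_pos (Γ.val_pos _) (Γ.mult_pos _))]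
  refine Finset.sum_congr rfl fun g _ => ?_
  congr 1
  exact (W.val_mul_mult d g).symm

/-- The covering homomorphism `A_Γ → A_{Γ_W}`; it sends the idempotent of an edge `i` to the sum of
the idempotents of the edges `i_g`, and an arrow `a` to the sum of the arrows `a_g`. -/
def coverHom : Γ.Alg →ₐ[K] (cover W).Alg :=
  RingQuot.liftAlgHom K ⟨coverHomKQ W, by
    rintro _ _ (⟨d, h, h'⟩ | ⟨d, h, h'⟩ | ⟨d, d', -, -, -, h⟩ | i)
    · rw [map_smul, map_smul, coverHomKQ_cyc_pow, coverHomKQ_cyc_pow, Finset.smul_sum,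
        Finset.smul_sum]
      refine Finset.sum_congr rfl fun g _ => ?_
      exact (cover W).rel_one (half W d g) (fun H => h ((truncated_half W d g).1 H))
        (fun H => h' ((truncated_half W _ g).1 H))
    · rw [map_mul, coverHomKQ_cyc_pow_eq, coverHomKQ_qArr, map_zero, walk_mul_a,
        walk_aSum W (Nat.succ_pos _)]
      refine Finset.sum_eq_zero fun g _ => ?_
      have := (cover W).rel_two (half W d g) ((truncated_half W _ g).2 h)
        (fun H => h' ((truncated_half W d g).1 H))
      rw [walk_mul_a] at this
      rw [← this]
      congr 2
      exact (W.val_mul_mult d g).symm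
    · rw [map_mul, coverHomKQ_qArr, coverHomKQ_qArr, map_zero]
      exact aSum_mul_of_ne W d d' h
    · rw [map_mul, coverHomKQ_loop, map_zero]
      exact xSum_mul_self W i.1⟩

/-! ### Graded modules and the forgetful functor -/

lemma coverHom_e (i : Γ.E) : coverHom W (Γ.e i) = eSum W i := by
  rw [coverHom, e, RingQuot.liftAlgHom_mkAlgHom_apply, coverHomKQ_vert]

lemma coverHom_a (d : Γ.D) : coverHom W (Γ.a d) = aSum W d := by
  rw [coverHom, a, RingQuot.liftAlgHom_mkAlgHom_apply, coverHomKQ_qArr]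

lemma coverHom_x (i : Γ.E) : coverHom W (Γ.x i) = xSum W i := by
  by_cases h : Γ.BiTruncated i
  · rw [coverHom, x, dif_pos h, RingQuot.liftAlgHom_mkAlgHom_apply, coverHomKQ_loop]
  · rw [x_of_not _ h, map_zero, xSum]
    exact (Finset.sum_eq_zero fun g _ =>
      (cover W).x_of_not fun H => h ((biTruncated_edgeAt W i g).1 H)).symm

/-- `IsPath W h p`: the element `p` of `A_Γ` is represented by a path of weight `h`, where an arrow
from an edge to its successor has the weight of that pair, and the extra loops have weight one. -/
inductive IsPath : G → Γ.Alg → Prop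
  | vertex (i : Γ.E) : IsPath 1 (Γ.e i)
  | arrow (d : Γ.D) (h : G) (p : Γ.Alg) : IsPath h p → IsPath (W.weight d * h) (Γ.a d * p)
  | loop (i : Γ.E) (h : G) (p : Γ.Alg) : IsPath h p → IsPath h (Γ.x i * p)

/-- The homogeneous elements of degree `h` of `A_Γ` in the grading induced by the weighting. -/
def degreePart (h : G) : Submodule K Γ.Alg := Submodule.span K {p | IsPath W h p}

open Classical in
/-- A `G`-graded (left) `A_Γ`-module. -/
structure GradedModule where
  carrier : ModuleCat.{w} Γ.Alg
  piece : G → AddSubgroup carrier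
  isInternal : DirectSum.IsInternal piece
  smul_mem : ∀ (h g : G) (r : Γ.Alg) (m : carrier), r ∈ degreePart W h → m ∈ piece g →
    r • m ∈ piece (h * g)

instance : Category (GradedModule.{u, v, w} W) where
  Hom M N := {f : M.carrier ⟶ N.carrier // ∀ g, ∀ m ∈ M.piece g, f m ∈ N.piece g}
  id M := ⟨𝟙 _, fun _ _ h => h⟩
  comp f f' := ⟨f.1 ≫ f'.1, fun g m h => f'.2 g _ (f.2 g m h)⟩

/-- Forgetting the grading. -/
def GradedModule.forget : GradedModule.{u, v, w} W ⥤ ModuleCat.{w} Γ.Alg where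
  obj M := M.carrier
  map f := f.1
  map_id _ := rfl
  map_comp _ _ := rfl

/-- The sum of the idempotents of the edges `i_g`, over all edges `i` of `Γ`. -/
def idem (g : G) : (cover W).Alg := ∑ i : Γ.E, (cover W).e (edgeAt W i g)

lemma idem_sum : ∑ g, idem W g = 1 := by
  simp only [idem]
  rw [Finset.sum_comm]
  exact eSum_sum W

lemma idem_mul (i : Γ.E) (g : G) (y : (cover W).Alg)
    (hy : (cover W).e (edgeAt W i g) * y = y) : idem W g * y = y := by
  rw [idem, ← hy, ← mul_assoc, Finset.sum_mul, Finset.sum_eq_single i]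
  · rw [e_mul_self]
  · intro j _ hne
    exact e_edgeAt_mul_ne W j i g g (Or.inl hne)
  · simp

lemma idem_mul_of_ne (i : Γ.E) (g h : G) (hgh : h ≠ g) (y : (cover W).Alg)
    (hy : (cover W).e (edgeAt W i g) * y = y) : idem W h * y = 0 := by
  rw [idem, ← hy, ← mul_assoc, Finset.sum_mul, Finset.sum_eq_zero, zero_mul]
  intro j _
  exact e_edgeAt_mul_ne W j i h g (Or.inr hgh)

lemma mul_idem (i : Γ.E) (g : G) (y : (cover W).Alg)
    (hy : y * (cover W).e (edgeAt W i g) = y) : y * idem W g = y := by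
  rw [idem, ← hy, mul_assoc, Finset.mul_sum, Finset.sum_eq_single i]
  · rw [e_mul_self]
  · intro j _ hne
    exact e_edgeAt_mul_ne W i j g g (Or.inl hne.symm)
  · simp

lemma mul_idem_of_ne (i : Γ.E) (g h : G) (hgh : g ≠ h) (y : (cover W).Alg)
    (hy : y * (cover W).e (edgeAt W i g) = y) : y * idem W h = 0 := by
  rw [idem, ← hy, mul_assoc, Finset.mul_sum, Finset.sum_eq_zero, mul_zero]
  intro j _
  exact e_edgeAt_mul_ne W i j g h (Or.inr hgh)

lemma idem_mul_self (g : G) : idem W g * idem W g = idem W g := by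
  nth_rw 2 [idem]
  rw [Finset.mul_sum]
  exact Finset.sum_congr rfl fun i _ => idem_mul W i g _ ((cover W).e_mul_self _)

lemma idem_mul_idem {g h : G} (hgh : g ≠ h) : idem W g * idem W h = 0 := by
  nth_rw 2 [idem]
  rw [Finset.mul_sum]
  exact Finset.sum_eq_zero fun i _ => idem_mul_of_ne W i h g hgh _ ((cover W).e_mul_self _)

lemma idem_mul_family (i j : Γ.E) (k : G) (f : G → (cover W).Alg) (c : G)
    (hl : ∀ g, (cover W).e (edgeAt W i g) * f g = f g)
    (hr : ∀ g, f g * (cover W).e (edgeAt W j (g * c)) = f g) :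
    idem W k * ∑ g, f g = (∑ g, f g) * idem W (k * c) := by
  rw [Finset.mul_sum, Finset.sum_mul]
  refine Finset.sum_congr rfl fun g _ => ?_
  by_cases h : k = g
  · rw [h, idem_mul W i g _ (hl g), mul_idem W j _ _ (hr g)]
  · rw [idem_mul_of_ne W i g k h _ (hl g),
      mul_idem_of_ne W j (g * c) (k * c) (fun H => h (mul_right_cancel H).symm) _ (hr g)]

lemma idem_mul_coverHom {h : G} {r : Γ.Alg} (hr : r ∈ degreePart W h) (k : G) :
    idem W k * coverHom W r = coverHom W r * idem W (k * h) := by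
  induction hr using Submodule.span_induction generalizing k with
  | mem p hp =>
    replace hp : IsPath W h p := hp
    induction hp generalizing k with
    | vertex i =>
      rw [coverHom_e]
      exact idem_mul_family W i i k _ 1 (fun g => (cover W).e_mul_self _)
        (fun g => by rw [mul_one, e_mul_self])
    | arrow d h p _ ih =>
      rw [map_mul, coverHom_a, ← mul_assoc, aSum, idem_mul_family W (Γ.edge d) (Γ.edge (Γ.succ d)) k
        (fun g => (cover W).a (half W d g)) (W.weight d) (fun g => (cover W).e_mul_a (half W d g))
        (fun g => (cover W).a_mul_e (half W d g)), mul_assoc, ih, ← mul_assoc, mul_assoc k]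
    | loop i h p _ ih =>
      rw [map_mul, coverHom_x, ← mul_assoc, xSum, idem_mul_family W i i k
        (fun g => (cover W).x (edgeAt W i g)) 1 (fun g => (cover W).e_mul_x (edgeAt W i g))
        (fun g => by rw [mul_one, x_mul_e]), mul_one, mul_assoc, ih, ← mul_assoc]
  | zero => simp
  | add r s _ _ h1 h2 => rw [map_add, mul_add, add_mul, h1, h2]
  | smul c r _ h1 => rw [map_smul, mul_smul_comm, smul_mul_assoc, h1]

/-- The homogeneous component of degree `g` of an `A_{Γ_W}`-module `M`: the sum of the `e(i_k) M`
over all edges `i`, where `k = g⁻¹` (the inverse appears since modules are left modules while paths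
are written from left to right). -/
def homPiece (M : ModuleCat.{w} (cover W).Alg) (g : G) : AddSubgroup M where
  carrier := {m | idem W g⁻¹ • m = m}
  zero_mem' := smul_zero _
  add_mem' {m n} hm hn := by
    have hm : idem W g⁻¹ • m = m := hm
    have hn : idem W g⁻¹ • n = n := hn
    change idem W g⁻¹ • (m + n) = m + n
    rw [smul_add, hm, hn]
  neg_mem' {m} hm := by
    have hm : idem W g⁻¹ • m = m := hm
    change idem W g⁻¹ • (-m) = -m
    rw [smul_neg, hm]

open Classical in
lemma homPiece_isInternal (M : ModuleCat.{w} (cover W).Alg) :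
    DirectSum.IsInternal (homPiece W M) := by
  constructor
  · rw [injective_iff_map_eq_zero]
    intro y hy
    rw [← DirectSum.sum_univ_of y, map_sum] at hy
    simp only [DirectSum.coeAddMonoidHom_of] at hy
    ext g
    have h := congrArg (fun m => idem W g⁻¹ • m) hy
    simp only [Finset.smul_sum, smul_zero] at h
    rw [Finset.sum_eq_single g] at h
    · exact (show _ = _ from (y g).2).symm.trans h
    · intro k _ hk
      have h1 : idem W k⁻¹ • (y k : M) = y k := (y k).2
      rw [← h1, ← mul_smul, idem_mul_idem W (fun H => hk (inv_injective H).symm), zero_smul]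
    · simp
  · intro m
    refine ⟨∑ g, DirectSum.of (fun g => homPiece W M g) g ⟨idem W g⁻¹ • m, ?_⟩, ?_⟩
    · change _ • _ • _ = _ • _
      rw [← mul_smul, idem_mul_self]
    · rw [map_sum]
      simp only [DirectSum.coeAddMonoidHom_of]
      rw [← Finset.sum_smul, show ∑ g : G, idem W g⁻¹ = 1 from
        (Equiv.sum_comp (Equiv.inv G) (idem W)).trans (idem_sum W), one_smul]

/-- Restriction of the action along the covering homomorphism. -/
def pull : ModuleCat.{w} (cover W).Alg ⥤ ModuleCat.{w} Γ.Alg :=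
  ModuleCat.restrictScalars (coverHom W).toRingHom

/-- An `A_{Γ_W}`-module regarded as a `G`-graded `A_Γ`-module: the underlying space is the same,
`A_Γ` acts through the covering homomorphism (an arrow `a` acts as the sum of the arrows `a_g`), and
the components are as in `homPiece`. -/
def gradedOf (M : ModuleCat.{w} (cover W).Alg) : GradedModule.{u, v, w} W where
  carrier := (pull W).obj M
  piece := homPiece W M
  isInternal := homPiece_isInternal W M
  smul_mem := by
    intro h g r m hr hm
    have hm : idem W g⁻¹ • (show M from m) = m := hm
    change idem W (h * g)⁻¹ • (coverHom W r • (show M from m)) = coverHom W r • (show M from m)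
    rw [← mul_smul, idem_mul_coverHom W hr, mul_smul, mul_inv_rev, inv_mul_cancel_right, hm]

lemma map_homPiece {M N : ModuleCat.{w} (cover W).Alg} (f : M ⟶ N) (g : G) (m : M)
    (hm : m ∈ homPiece W M g) : f m ∈ homPiece W N g := by
  have hm : idem W g⁻¹ • m = m := hm
  change idem W g⁻¹ • f.hom m = f.hom m
  rw [← map_smul, hm]

/-- The functor from `A_{Γ_W}`-modules to `G`-graded `A_Γ`-modules; it is the identity on underlying
maps. -/
def toGraded : ModuleCat.{w} (cover W).Alg ⥤ GradedModule.{u, v, w} W where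
  obj M := gradedOf W M
  map {M N} f := Subtype.mk (p := fun f : (gradedOf W M).carrier ⟶ (gradedOf W N).carrier =>
      ∀ g, ∀ m ∈ (gradedOf W M).piece g, f m ∈ (gradedOf W N).piece g)
    ((pull W).map f) (map_homPiece W f)
  map_id _ := rfl
  map_comp _ _ := rfl

/-- The forgetful functor `Mod(A_{Γ_W}) ⥤ Mod(A_Γ)`. -/
def forgetful : ModuleCat.{w} (cover W).Alg ⥤ ModuleCat.{w} Γ.Alg :=
  toGraded W ⋙ GradedModule.forget W

end QuantizedBrauerGraph

/-! ### Towers -/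

/-- `BrauerTower K n Δ₀ Δₙ`: a tower of quantized Brauer covering graphs of length `n`, with bottom
`Δ₀` and top `Δₙ`. -/
inductive BrauerTower (K : Type u) [Field K] :
    ℕ → QuantizedBrauerGraph.{u, v} K → QuantizedBrauerGraph.{u, v} K → Type (max u (v + 1))
  | base (Δ : QuantizedBrauerGraph.{u, v} K) : BrauerTower K 0 Δ Δ
  | step {n : ℕ} {Δ₀ Δ : QuantizedBrauerGraph.{u, v} K} (t : BrauerTower K n Δ₀ Δ)
      (G : Type v) [CommGroup G] [Fintype G] (W : Δ.toBrauerGraph.Weighting G) :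
      BrauerTower K (n + 1) Δ₀ (QuantizedBrauerGraph.cover W)

/-- The composite of the forgetful functors along a tower. -/
def BrauerTower.functor {K : Type u} [Field K] {n : ℕ} {Δ₀ Δ : QuantizedBrauerGraph.{u, v} K}
    (t : BrauerTower K n Δ₀ Δ) : ModuleCat.{w} Δ.Alg ⥤ ModuleCat.{w} Δ₀.Alg :=
  match t with
  | .base _ => 𝟭 _
  | @BrauerTower.step _ _ _ _ _ t _ _ _ W => QuantizedBrauerGraph.forgetful W ⋙ t.functor

/-! ### Minimal projective resolutions -/

/-- A submodule `N` of `M` is superfluous if `N + L = M` implies `L = M`. -/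
def IsSuperfluous {R M : Type*} [Ring R] [AddCommGroup M] [Module R M] (N : Submodule R M) : Prop :=
  ∀ L : Submodule R M, N ⊔ L = ⊤ → L = ⊤

/-- `⋯ → P 2 → P 1 → P 0 → T → 0` is a minimal projective resolution of `T`: the sequence is exact,
all `P n` are projective, and every map from `P n` onto its image is a projective cover. -/
structure IsMinimalProjectiveResolution {R : Type*} [Ring R] (P : ℕ → ModuleCat.{w} R)
    (d : ∀ n, P (n + 1) ⟶ P n) {T : ModuleCat.{w} R} (ε : P 0 ⟶ T) : Prop where
  projective : ∀ n, Module.Projective R (P n)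
  surjective : Function.Surjective ε
  exact_zero : Function.Exact (d 0) ε
  exact_succ : ∀ n, Function.Exact (d (n + 1)) (d n)
  minimal_zero : IsSuperfluous (LinearMap.ker ε.hom)
  minimal_succ : ∀ n, IsSuperfluous (LinearMap.ker (d n).hom)

end

/-!
The forgetful functor along one covering `Γ_W → Γ` is restriction of scalars along the covering
homomorphism `φ : A → B` from `A = A_Γ` to `B = A_{Γ_W}`, so it is the identity on underlying sets
and maps, and exactness is immediate.  The other statements are proved for one covering and follow
for a tower by induction.

*Radicals.*  In a Brauer graph algebra the arrows generate a nilpotent ideal `J` (a nonzero product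
of arrows runs around a single vertex, and it cannot be longer than `C ^ m`:
`QuantizedBrauerGraph.walk_eq_zero`), and modulo `J` the algebra is a quotient of `K × ⋯ × K`.  Hence
simple modules are one-dimensional, given by characters at the vertices of the quiver, and a
submodule of a module `M` is superfluous if and only if it is contained in `J M`
(`IsArrowGenerated.isSuperfluous_iff`).

*Simple modules.*  A `B`-module that is one-dimensional over `K` is simple over `A`, and the
character of `A` at an edge `i` is the restriction along `φ` of the character of `B` at the edge
`i_1`.

*Projective modules.*  It is enough that `B` is projective as a left `A`-module
(`QuantizedBrauerGraph.projective_cover`).  The algebra `B` acts by matrices over `A` with rows and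
columns indexed by `G`, where the arrow `d_g` has the single entry `a_d` in position `(g, g W(d))`.
Every column of the matrix of `φ r` sums to `r`, so that taking column sums is an `A`-linear map
`B → A ^ G`; it is split by `r ↦ ∑ h, φ (r h) * idem h`, because the elements `φ r * idem h` span `B`.

*Minimality.*  Every arrow of `B` is the image of an arrow of `A` times an idempotent, so
`J_B M ⊆ J_A M` for every `B`-module `M`, and a submodule that is superfluous over `B` is superfluous
over `A`.
-/

noncomputable section

/-! ### Algebras generated by orthogonal idempotents and nilpotent arrows -/

/-- The `K`-algebra `B` is generated by a finite complete family `e` of orthogonal idempotents and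
by a family `r` of elements ("arrows"), each starting at one of the idempotents, such that all
sufficiently long products of arrows vanish.  This is what is used of a finite-dimensional
quotient of a path algebra: the arrows generate a nilpotent ideal modulo which `B` is a quotient of
`K × ⋯ × K`.  The idempotents are allowed to be zero. -/
structure IsArrowGenerated (K : Type*) {B ι X : Type*} [Field K] [Ring B] [Algebra K B] [Fintype ι]
    (e : ι → B) (r : X → B) : Prop where
  sum_eq_one : ∑ i, e i = 1
  mul_self : ∀ i, e i * e i = e i
  mul_of_ne : ∀ i j, i ≠ j → e i * e j = 0
  source : ∀ x, ∃ i, e i * r x = r x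
  adjoin_eq_top : Algebra.adjoin K (Set.range e ∪ Set.range r) = ⊤
  nilpotent : ∃ N : ℕ, ∀ l : List X, N ≤ l.length → (l.map r).prod = 0

/-- The product of the ideal of arrows with a module `M`, as a `K`-subspace: the span of all
`r x • m`. -/
def arrowSpan (K : Type*) {B X : Type*} [Field K] [Ring B] (r : X → B) (M : Type*)
    [AddCommGroup M] [Module K M] [Module B M] : Submodule K M :=
  Submodule.span K (Set.range fun p : X × M => r p.1 • p.2)

lemma smul_mem_arrowSpan (K : Type*) {B X M : Type*} [Field K] [Ring B] (r : X → B)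
    [AddCommGroup M] [Module K M] [Module B M] (x : X) (m : M) : r x • m ∈ arrowSpan K r M :=
  Submodule.subset_span ⟨(x, m), rfl⟩

/-- A module that is simple already over the base field of an algebra is simple over the algebra. -/
lemma IsSimpleModule.of_scalarTower (K A : Type*) {S : Type*} [Field K] [Ring A] [Algebra K A]
    [AddCommGroup S] [Module K S] [Module A S] [IsScalarTower K A S] [IsSimpleModule K S] :
    IsSimpleModule A S := by
  have : Nontrivial S := IsSimpleModule.nontrivial K S
  rw [isSimpleModule_iff]
  refine ⟨fun L => ?_⟩
  rcases eq_bot_or_eq_top (L.restrictScalars K) with h | h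
  · exact Or.inl (by simpa using h)
  · exact Or.inr (by simpa using h)

namespace IsArrowGenerated

variable {K B ι X M : Type*} [Field K] [Ring B] [Algebra K B] [Fintype ι] {e : ι → B} {r : X → B}
  [AddCommGroup M] [Module K M] [Module B M] [IsScalarTower K B M]

/-- A subspace that is stable under the idempotents and the arrows is a submodule. -/
lemma smul_mem_of_stable (hB : IsArrowGenerated K e r) (L : Submodule K M)
    (he : ∀ i, ∀ m ∈ L, e i • m ∈ L) (hr : ∀ x, ∀ m ∈ L, r x • m ∈ L) (b : B) (m : M)
    (hm : m ∈ L) : b • m ∈ L := by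
  have hb : b ∈ Algebra.adjoin K (Set.range e ∪ Set.range r) := by
    rw [hB.adjoin_eq_top]; trivial
  induction hb using Algebra.adjoin_induction generalizing m with
  | mem b hb =>
    rcases hb with ⟨i, rfl⟩ | ⟨x, rfl⟩
    · exact he i m hm
    · exact hr x m hm
  | algebraMap c =>
    rw [algebraMap_smul]
    exact L.smul_mem c hm
  | add b c _ _ h1 h2 =>
    rw [add_smul]
    exact L.add_mem (h1 m hm) (h2 m hm)
  | mul b c _ _ h1 h2 =>
    rw [mul_smul]
    exact h1 _ (h2 m hm)

lemma sum_smul (hB : IsArrowGenerated K e r) (m : M) : ∑ i, e i • m = m := by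
  rw [← Finset.sum_smul, hB.sum_eq_one, one_smul]

/-- Nakayama's lemma for the nilpotent ideal of arrows. -/
lemma eq_top_of_arrowSpan_sup (hB : IsArrowGenerated K e r) (L : Submodule B M)
    (h : arrowSpan K r M ⊔ L.restrictScalars K = ⊤) : L = ⊤ := by
  obtain ⟨N, hN⟩ := hB.nilpotent
  -- descending induction on the length of a product of arrows that is applied to `M`
  have key : ∀ k : ℕ, ∀ l : List X, N ≤ l.length + k → ∀ m : M, (l.map r).prod • m ∈ L := by
    intro k
    induction k with
    | zero =>
      intro l hl m
      rw [hN l (by simpa using hl), zero_smul]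
      exact L.zero_mem
    | succ k ih =>
      intro l hl m
      obtain ⟨y, hy, z, hz, rfl⟩ := Submodule.mem_sup.1 (h.ge (Submodule.mem_top (x := m)))
      rw [smul_add]
      refine L.add_mem ?_ (L.smul_mem _ hz)
      induction hy using Submodule.span_induction with
      | mem y hy =>
        obtain ⟨⟨x, m'⟩, rfl⟩ := hy
        have := ih (l ++ [x]) (by simp; omega) m'
        simpa [mul_smul] using this
      | zero => simp
      | add y y' _ _ h1 h2 =>
        rw [smul_add]
        exact L.add_mem h1 h2
      | smul c y _ h1 =>
        rw [← algebraMap_smul B c y, ← mul_smul, ← Algebra.commutes, mul_smul]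
        exact L.smul_mem _ h1
  refine eq_top_iff.2 fun m _ => ?_
  simpa using key N [] (by simp) m

/-- A submodule is superfluous exactly when it is contained in the radical.  If `N` is not
contained in the radical, some `e i • n` with `n ∈ N` is not, and a linear form that vanishes on the
radical and on all `e j • M` with `j ≠ i` but not on `e i • n` has a submodule as its kernel, which
together with `N` generates `M`. -/
lemma isSuperfluous_iff (hB : IsArrowGenerated K e r) (N : Submodule B M) :
    IsSuperfluous N ↔ N.restrictScalars K ≤ arrowSpan K r M := by
  constructor
  · intro hN n hn
    have hn : n ∈ N := hn
    by_contra hnot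
    obtain ⟨i, hi⟩ : ∃ i, e i • n ∉ arrowSpan K r M := by
      by_contra! H
      exact hnot (hB.sum_smul n ▸ Submodule.sum_mem _ fun i _ => H i)
    obtain ⟨f, hf, hJ⟩ := Submodule.exists_le_ker_of_notMem hi
    have hei : e i • e i • n = e i • n := by rw [← mul_smul, hB.mul_self]
    let L : Submodule B M :=
      { carrier := {m | f (e i • m) = 0}
        zero_mem' := by simp
        add_mem' := by
          intro m m' hm hm'
          have hm : f (e i • m) = 0 := hm
          have hm' : f (e i • m') = 0 := hm'
          change f (e i • (m + m')) = 0
          rw [smul_add, map_add, hm, hm', add_zero]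
        smul_mem' := by
          intro b m hm
          let L' : Submodule K M := LinearMap.ker
            (f ∘ₗ ({ toFun := fun m => e i • m
                     map_add' := smul_add _
                     map_smul' := fun c m => by
                      rw [← algebraMap_smul B c m, ← mul_smul, ← Algebra.commutes, mul_smul,
                        algebraMap_smul, RingHom.id_apply] } : M →ₗ[K] M))
          refine hB.smul_mem_of_stable L' ?_ ?_ b m hm
          · intro j m hm
            have hm : f (e i • m) = 0 := hm
            change f (e i • e j • m) = 0
            by_cases hij : i = j
            · rw [← hij, ← mul_smul, hB.mul_self, hm]
            · rw [← mul_smul, hB.mul_of_ne i j hij, zero_smul, map_zero]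
          · intro x m _
            change f (e i • r x • m) = 0
            obtain ⟨j, hj⟩ := hB.source x
            by_cases hij : i = j
            · rw [← mul_smul, hij, hj]
              exact hJ (smul_mem_arrowSpan K r x m)
            · rw [← hj, ← mul_smul, ← mul_assoc, hB.mul_of_ne i j hij, zero_mul, zero_smul,
                map_zero] }
    have hL : L = ⊤ := by
      refine hN L (eq_top_iff.2 fun m _ => ?_)
      refine Submodule.mem_sup.2 ⟨algebraMap K B (f (e i • m) / f (e i • n)) • e i • n,
        N.smul_mem _ (N.smul_mem _ hn), m - algebraMap K B (f (e i • m) / f (e i • n)) • e i • n,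
        ?_, add_sub_cancel _ _⟩
      change f (e i • (m - _)) = 0
      rw [smul_sub, ← mul_smul (e i), ← Algebra.commutes, mul_smul, hei, algebraMap_smul, map_sub,
        map_smul f (f (e i • m) / f (e i • n)), smul_eq_mul, div_mul_cancel₀ _ hf, sub_self]
    have : n ∈ L := hL ▸ Submodule.mem_top
    exact hf this
  · intro hN L hL
    refine hB.eq_top_of_arrowSpan_sup L (eq_top_iff.2 ?_)
    intro m _
    obtain ⟨y, hy, z, hz, rfl⟩ := Submodule.mem_sup.1 (hL.ge (Submodule.mem_top (x := m)))
    exact Submodule.add_mem_sup (hN hy) hz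

/-- On a simple module all arrows act as zero, and some idempotent acts as the identity. -/
lemma exists_vertex (hB : IsArrowGenerated K e r) [IsSimpleModule B M] :
    (∀ x, ∀ m : M, r x • m = 0) ∧ ∃ i, ∀ m : M, e i • m = m := by
  have : Nontrivial M := IsSimpleModule.nontrivial B M
  have hstable : ∀ (b : B), ∀ m ∈ arrowSpan K r M, b • m ∈ arrowSpan K r M := by
    intro b m hm
    refine hB.smul_mem_of_stable (arrowSpan K r M) ?_ ?_ b m hm
    · intro i m hm
      induction hm using Submodule.span_induction with
      | mem y hy =>
        obtain ⟨⟨x, m'⟩, rfl⟩ := hy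
        obtain ⟨j, hj⟩ := hB.source x
        by_cases hij : i = j
        · change e i • r x • m' ∈ _
          rw [← mul_smul, hij, hj]
          exact smul_mem_arrowSpan K r x m'
        · change e i • r x • m' ∈ _
          rw [← hj, ← mul_smul, ← mul_assoc, hB.mul_of_ne i j hij, zero_mul, zero_smul]
          exact Submodule.zero_mem _
      | zero => simp
      | add y y' _ _ h1 h2 =>
        rw [smul_add]
        exact Submodule.add_mem _ h1 h2
      | smul c y _ h1 =>
        rw [← algebraMap_smul B c y, ← mul_smul, ← Algebra.commutes, mul_smul, algebraMap_smul]
        exact Submodule.smul_mem _ _ h1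
    · exact fun x m _ => smul_mem_arrowSpan K r x m
  -- by Nakayama's lemma, the submodule `J` spanned by the `r x • m` is proper, hence zero
  let J : Submodule B M :=
    { carrier := arrowSpan K r M
      zero_mem' := Submodule.zero_mem _
      add_mem' := fun h h' => Submodule.add_mem _ h h'
      smul_mem' := fun b m hm => hstable b m hm }
  have hJ : J = ⊥ := by
    refine (eq_bot_or_eq_top J).resolve_right fun h => ?_
    have := hB.eq_top_of_arrowSpan_sup (⊥ : Submodule B M) (eq_top_iff.2 fun m _ =>
      Submodule.mem_sup_left (show m ∈ J from h ▸ Submodule.mem_top))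
    exact bot_ne_top this
  have hr : ∀ x, ∀ m : M, r x • m = 0 := fun x m =>
    (Submodule.mem_bot B).1 (hJ ▸ (smul_mem_arrowSpan K r x m : r x • m ∈ J))
  refine ⟨hr, ?_⟩
  obtain ⟨m₀, hm₀⟩ := exists_ne (0 : M)
  obtain ⟨i, hi⟩ : ∃ i, e i • m₀ ≠ 0 := by
    by_contra! H
    exact hm₀ (by rw [← hB.sum_smul m₀]; exact Finset.sum_eq_zero fun i _ => H i)
  refine ⟨i, ?_⟩
  -- since the arrows act as zero, the image of `e i` is a submodule
  let E : Submodule K M :=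
    { carrier := {m | e i • m = m}
      zero_mem' := smul_zero _
      add_mem' := by
        intro m m' hm hm'
        have hm : e i • m = m := hm
        have hm' : e i • m' = m' := hm'
        change e i • (m + m') = m + m'
        rw [smul_add, hm, hm']
      smul_mem' := by
        intro c m hm
        have hm : e i • m = m := hm
        change e i • c • m = c • m
        rw [← algebraMap_smul B c m, ← mul_smul, ← Algebra.commutes, mul_smul, hm] }
  let L : Submodule B M :=
    { carrier := E
      zero_mem' := E.zero_mem
      add_mem' := fun h h' => E.add_mem h h'
      smul_mem' := fun b m hm => by
        refine hB.smul_mem_of_stable E ?_ ?_ b m hm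
        · intro j m hm
          by_cases hij : i = j
          · change e i • e j • m = e j • m
            rw [← mul_smul, ← hij, hB.mul_self]
          · have hm : e i • m = m := hm
            have : e j • m = 0 := by
              rw [← hm, ← mul_smul, hB.mul_of_ne j i (Ne.symm hij), zero_smul]
            rw [this]
            exact E.zero_mem
        · intro x m _
          rw [hr x m]
          exact E.zero_mem }
  have hL : L = ⊤ := by
    refine (eq_bot_or_eq_top L).resolve_left fun h => hi ?_
    have : e i • m₀ ∈ L := by
      change e i • e i • m₀ = e i • m₀
      rw [← mul_smul, hB.mul_self]
    rw [h] at this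
    exact (Submodule.mem_bot B).1 this
  intro m
  have : m ∈ L := hL ▸ Submodule.mem_top
  exact this

lemma smul_eq_zero_of_ne (hB : IsArrowGenerated K e r) {i j : ι} (hij : j ≠ i)
    (hi : ∀ m : M, e i • m = m) (m : M) : e j • m = 0 := by
  rw [← hi m, ← mul_smul, hB.mul_of_ne j i hij, zero_smul]

variable (K M) in
/-- A simple module is one-dimensional over the base field. -/
lemma isSimpleModule_field (hB : IsArrowGenerated K e r) [IsSimpleModule B M] :
    IsSimpleModule K M := by
  obtain ⟨hr, i, hi⟩ := hB.exists_vertex (M := M)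
  have : Nontrivial M := IsSimpleModule.nontrivial B M
  rw [isSimpleModule_iff]
  refine ⟨fun L => ?_⟩
  -- all generators of `B` act as `0` or `1`, so that every subspace is a submodule
  let L' : Submodule B M :=
    { carrier := L
      zero_mem' := L.zero_mem
      add_mem' := fun h h' => L.add_mem h h'
      smul_mem' := fun b m hm => by
        refine hB.smul_mem_of_stable L ?_ ?_ b m hm
        · intro j m hm
          by_cases hij : j = i
          · rwa [hij, hi]
          · rw [hB.smul_eq_zero_of_ne hij hi]
            exact L.zero_mem
        · intro x m _
          rw [hr x m]
          exact L.zero_mem }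
  rcases eq_bot_or_eq_top L' with h | h
  · left
    exact eq_bot_iff.2 fun m hm => (Submodule.mem_bot B).1 (h ▸ (hm : m ∈ L'))
  · right
    exact eq_top_iff.2 fun m _ => (h ▸ Submodule.mem_top : m ∈ L')

end IsArrowGenerated

/-! ### Restriction of scalars -/

/-- Projectivity is preserved by restriction of scalars along a ring homomorphism `A → B` for which
`B` is a projective left `A`-module. -/
lemma Module.Projective.of_scalarTower (A B : Type*) {M : Type*} [Ring A] [Ring B] [AddCommGroup M]
    [Module A B] [IsScalarTower A B B] [Module B M] [Module A M] [IsScalarTower A B M]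
    [Module.Projective A B] [Module.Projective B M] : Module.Projective A M := by
  classical
  obtain ⟨s, hs⟩ := (Module.projective_def' (R := B) (P := M)).1 inferInstance
  have : Module.Projective A (M →₀ B) :=
    Module.Projective.of_equiv (finsuppLequivDFinsupp (ι := M) (M := B) A).symm
  refine Module.Projective.of_split (s.restrictScalars A)
    ((Finsupp.linearCombination B (id : M → M)).restrictScalars A) ?_
  ext m
  exact LinearMap.congr_fun hs m

/-- If `A` and `B` are both generated by idempotents and arrows, and every arrow of `B` is an arrow
of `A` times an element of `B`, then a superfluous submodule over `B` stays superfluous over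
`A`. -/
lemma IsArrowGenerated.isSuperfluous_of_scalarTower {K A B ι X ι' X' M : Type*} [Field K] [Ring A]
    [Algebra K A] [Ring B] [Algebra K B] [Fintype ι] [Fintype ι'] {e : ι → A} {r : X → A}
    {e' : ι' → B} {r' : X' → B} (hA : IsArrowGenerated K e r) (hB : IsArrowGenerated K e' r')
    [AddCommGroup M] [Module K M] [Module A M] [Module B M] [IsScalarTower K A M]
    [IsScalarTower K B M] [Module A B] [IsScalarTower A B M]
    (h : ∀ x', ∃ x, ∃ b : B, r' x' = r x • b) (N : Submodule B M) (N' : Submodule A M)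
    (hNN' : ∀ m, m ∈ N' → m ∈ N) (hN : IsSuperfluous N) : IsSuperfluous N' := by
  rw [hB.isSuperfluous_iff] at hN
  rw [hA.isSuperfluous_iff]
  intro m hm
  refine (Submodule.span_le.2 ?_ : arrowSpan K r' M ≤ arrowSpan K r M) (hN (hNN' m hm))
  rintro _ ⟨⟨x', m⟩, rfl⟩
  obtain ⟨x, b, hx⟩ := h x'
  simp only [hx, smul_assoc]
  exact smul_mem_arrowSpan K r x _

/-! ### Brauer graph algebras are generated by idempotents and nilpotent arrows -/

namespace QuantizedBrauerGraph

section Generation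

variable {K : Type u} [Field K] (Γ : QuantizedBrauerGraph.{u, v} K)

/-- All arrows of the quiver, as elements of the algebra (with some zeros by convention). -/
def arrows : Γ.D ⊕ Γ.E → Γ.Alg := Sum.elim Γ.a Γ.x

lemma adjoin_eq_top :
    Algebra.adjoin K (Set.range Γ.e ∪ Set.range Γ.arrows) = (⊤ : Subalgebra K Γ.Alg) := by
  let π : FreeAlgebra K (Γ.E ⊕ Γ.Arrow) →ₐ[K] Γ.Alg :=
    (RingQuot.mkAlgHom K Γ.BrauerRel).comp (RingQuot.mkAlgHom K (PathRel K Γ.source Γ.target))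
  have hπ : Function.Surjective π :=
    (RingQuot.mkAlgHom_surjective K _).comp (RingQuot.mkAlgHom_surjective K _)
  rw [← (AlgHom.range_eq_top π).2 hπ, ← Algebra.map_top, ← FreeAlgebra.adjoin_range_ι,
    AlgHom.map_adjoin]
  refine le_antisymm (Algebra.adjoin_le ?_) (Algebra.adjoin_mono ?_)
  · rw [← AlgHom.map_adjoin, FreeAlgebra.adjoin_range_ι, Algebra.map_top,
      (AlgHom.range_eq_top π).2 hπ]
    exact Set.subset_univ _
  · rintro _ ⟨_, ⟨i | d | i, rfl⟩, rfl⟩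
    · exact Or.inl ⟨i, rfl⟩
    · refine Or.inr ⟨Sum.inl d.1, ?_⟩
      change Γ.a d.1 = _
      rw [a, qArr, dif_neg d.2]
      rfl
    · refine Or.inr ⟨Sum.inr i.1, ?_⟩
      change Γ.x i.1 = _
      rw [x, dif_pos i.2]
      rfl

lemma x_mul_a (i : Γ.E) (d : Γ.D) : Γ.x i * Γ.a d = 0 := by
  by_cases hi : Γ.BiTruncated i
  · by_cases h : i = Γ.edge d
    · rw [Γ.a_of_truncated (hi d h.symm), mul_zero]
    · rw [← Γ.x_mul_e, ← Γ.e_mul_a d, mul_assoc, ← mul_assoc (Γ.e _), Γ.e_mul_of_ne h, zero_mul,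
        mul_zero]
  · rw [Γ.x_of_not hi, zero_mul]

lemma a_mul_x (d : Γ.D) (i : Γ.E) : Γ.a d * Γ.x i = 0 := by
  by_cases hi : Γ.BiTruncated i
  · by_cases h : Γ.edge (Γ.succ d) = i
    · rw [Γ.a_of_truncated ((Γ.truncated_succ d).1 (hi _ h)), zero_mul]
    · rw [← Γ.a_mul_e, ← Γ.e_mul_x i, mul_assoc, ← mul_assoc (Γ.e _), Γ.e_mul_of_ne h, zero_mul,
        mul_zero]
  · rw [Γ.x_of_not hi, mul_zero]

lemma x_mul_x (i j : Γ.E) : Γ.x i * Γ.x j = 0 := by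
  by_cases h : i = j
  · rw [h, x_mul_self]
  · rw [← Γ.x_mul_e, ← Γ.e_mul_x j, mul_assoc, ← mul_assoc (Γ.e _), Γ.e_mul_of_ne h, zero_mul,
      mul_zero]

/-- A path around a vertex that is one arrow longer than `C ^ m` is zero.  If the edge is
truncated at its other endpoint, this is a relation of type two.  Otherwise the relations of type
one replace `C ^ m` by the corresponding power at the other endpoint, and the composition with the
last arrow contains a product that vanishes by the relations of type three. -/
lemma walk_mul_a_eq_zero (d : Γ.D) :
    walk Γ.succ Γ.a (Γ.val (Γ.vertex d) * Γ.mult (Γ.vertex d)) d * Γ.a d = 0 := by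
  by_cases h : Γ.Truncated d
  · rw [Γ.a_of_truncated h, mul_zero]
  by_cases h' : Γ.Truncated (Γ.flip d)
  · exact Γ.rel_two d h' h
  have hq : (Γ.q d : K) ≠ 0 := (Γ.q d).ne_zero
  refine (smul_eq_zero_iff_right hq).1 ?_
  rw [← smul_mul_assoc, Γ.rel_one d h h', smul_mul_assoc]
  obtain ⟨n, hn⟩ := Nat.exists_eq_succ_of_ne_zero
    (Nat.mul_pos (Γ.val_pos (Γ.vertex (Γ.flip d))) (Γ.mult_pos (Γ.vertex (Γ.flip d)))).ne'
  have hd : Γ.succ ((Γ.succ^[n]) (Γ.flip d)) = Γ.flip d := by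
    rw [← Function.iterate_succ_apply' Γ.succ n, ← hn, ← Equiv.Perm.coe_pow, Γ.pow_val_mul]
  rw [hn, Nat.succ_eq_add_one, walk_add, mul_assoc]
  rw [show walk Γ.succ Γ.a 1 (Γ.succ^[n] (Γ.flip d)) = Γ.a (Γ.succ^[n] (Γ.flip d)) from mul_one _,
    Γ.rel_three, mul_zero, smul_zero]
  rw [hd]
  exact (Γ.flip_ne d).symm

lemma walk_eq_zero (d : Γ.D) (n : ℕ)
    (hn : Γ.val (Γ.vertex d) * Γ.mult (Γ.vertex d) < n) : walk Γ.succ Γ.a n d = 0 := by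
  obtain ⟨k, rfl⟩ := Nat.exists_eq_add_of_lt hn
  rw [add_right_comm, walk_add, ← walk_mul_a, walk_mul_a_eq_zero, zero_mul]

/-- A product of at least two arrows vanishes unless it runs around a single vertex. -/
lemma prod_arrows (α : Γ.D ⊕ Γ.E) (l : List (Γ.D ⊕ Γ.E)) :
    ((α :: l).map Γ.arrows).prod = 0 ∨ l = [] ∨
      ∃ d, α = Sum.inl d ∧ ((α :: l).map Γ.arrows).prod = walk Γ.succ Γ.a (l.length + 1) d := by
  induction l generalizing α with
  | nil => exact Or.inr (Or.inl rfl)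
  | cons β l ih =>
    rw [List.map_cons, List.prod_cons]
    rcases ih β with h | rfl | ⟨d, rfl, h⟩
    · exact Or.inl (by rw [h, mul_zero])
    · rcases α with d | i <;> rcases β with d' | j
      · by_cases hd : d' = Γ.succ d
        · refine Or.inr (Or.inr ⟨d, rfl, ?_⟩)
          simp [arrows, walk, hd]
        · left
          simp [arrows, Γ.rel_three d d' hd]
      · left
        simp [arrows, a_mul_x]
      · left
        simp [arrows, x_mul_a]
      · left
        simp [arrows, x_mul_x]
    · rw [h]
      rcases α with d' | i
      · by_cases hd : d = Γ.succ d'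
        · refine Or.inr (Or.inr ⟨d', rfl, ?_⟩)
          rw [hd, List.length_cons]
          rfl
        · left
          rw [walk, ← mul_assoc, arrows, Sum.elim_inl, Γ.rel_three d' d hd, zero_mul]
      · left
        rw [walk, ← mul_assoc, arrows, Sum.elim_inr, x_mul_a, zero_mul]

lemma isArrowGenerated : IsArrowGenerated K Γ.e Γ.arrows where
  sum_eq_one := Γ.e_sum
  mul_self := Γ.e_mul_self
  mul_of_ne _ _ h := Γ.e_mul_of_ne h
  source := by
    rintro (d | i)
    · exact ⟨_, Γ.e_mul_a d⟩
    · exact ⟨_, Γ.e_mul_x i⟩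
  adjoin_eq_top := Γ.adjoin_eq_top
  nilpotent := by
    refine ⟨2 + ∑ d : Γ.D, Γ.val (Γ.vertex d) * Γ.mult (Γ.vertex d), fun l hl => ?_⟩
    rcases l with _ | ⟨α, l⟩
    · simp at hl
    · rw [List.length_cons] at hl
      rcases Γ.prod_arrows α l with h | rfl | ⟨d, rfl, h⟩
      · exact h
      · rw [List.length_nil] at hl
        omega
      · rw [h]
        apply walk_eq_zero
        have := Finset.single_le_sum (f := fun d : Γ.D => Γ.val (Γ.vertex d) * Γ.mult (Γ.vertex d))
          (fun _ _ => Nat.zero_le _) (Finset.mem_univ d)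
        omega

/-! ### The universal property of a Brauer graph algebra -/

/-- Elements of a `K`-algebra `R` that satisfy the relations defining the Brauer graph algebra. -/
structure Realization (R : Type*) [Ring R] [Algebra K R] where
  e : Γ.E → R
  a : Γ.D → R
  x : Γ.E → R
  e_sum : ∑ i, e i = 1
  e_mul_self : ∀ i, e i * e i = e i
  e_mul_of_ne : ∀ i j, i ≠ j → e i * e j = 0
  e_mul_a : ∀ d, e (Γ.edge d) * a d = a d
  a_mul_e : ∀ d, a d * e (Γ.edge (Γ.succ d)) = a d
  e_mul_x : ∀ i, e i * x i = x i
  x_mul_e : ∀ i, x i * e i = x i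
  a_of_truncated : ∀ d, Γ.Truncated d → a d = 0
  x_of_not : ∀ i, ¬ Γ.BiTruncated i → x i = 0
  rel_one : ∀ d, ¬ Γ.Truncated d → ¬ Γ.Truncated (Γ.flip d) →
    (Γ.q d : K) • walk Γ.succ a (Γ.val (Γ.vertex d) * Γ.mult (Γ.vertex d)) d =
      (Γ.q (Γ.flip d) : K) • walk Γ.succ a
        (Γ.val (Γ.vertex (Γ.flip d)) * Γ.mult (Γ.vertex (Γ.flip d))) (Γ.flip d)
  rel_two : ∀ d, Γ.Truncated (Γ.flip d) → ¬ Γ.Truncated d →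
    walk Γ.succ a (Γ.val (Γ.vertex d) * Γ.mult (Γ.vertex d)) d * a d = 0
  rel_three : ∀ d d', d' ≠ Γ.succ d → a d * a d' = 0
  x_mul_self : ∀ i, x i * x i = 0

namespace Realization

variable {Γ} {R : Type*} [Ring R] [Algebra K R] (ρ : Γ.Realization R)

/-- The values of a realization on the vertices and arrows of the quiver. -/
def gens : Γ.E ⊕ Γ.Arrow → R
  | Sum.inl i => ρ.e i
  | Sum.inr (Sum.inl d) => ρ.a d.1
  | Sum.inr (Sum.inr i) => ρ.x i.1

/-- The homomorphism from the path algebra given by a realization. -/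
def liftKQ : Γ.KQ →ₐ[K] R :=
  RingQuot.liftAlgHom K ⟨FreeAlgebra.lift K ρ.gens, by
    rintro _ _ (_ | i | ⟨i, j, h⟩ | (d | i) | (d | i))
    · simpa [gens, BrauerGraph.source, BrauerGraph.target] using ρ.e_sum
    · simpa [gens, BrauerGraph.source, BrauerGraph.target] using ρ.e_mul_self i
    · simpa [gens, BrauerGraph.source, BrauerGraph.target] using ρ.e_mul_of_ne i j h
    · simpa [gens, BrauerGraph.source, BrauerGraph.target] using ρ.e_mul_a d.1
    · simpa [gens, BrauerGraph.source, BrauerGraph.target] using ρ.e_mul_x i.1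
    · simpa [gens, BrauerGraph.source, BrauerGraph.target] using ρ.a_mul_e d.1
    · simpa [gens, BrauerGraph.source, BrauerGraph.target] using ρ.x_mul_e i.1⟩

lemma liftKQ_vert (i : Γ.E) : ρ.liftKQ (PathAlgebra.vert K Γ.source Γ.target i) = ρ.e i := by
  simp [gens, liftKQ, PathAlgebra.vert]

lemma liftKQ_loop (i : {e : Γ.E // Γ.BiTruncated e}) :
    ρ.liftKQ (PathAlgebra.arr K Γ.source Γ.target (Sum.inr i)) = ρ.x i.1 := by
  simp [gens, liftKQ, PathAlgebra.arr]

lemma liftKQ_qArr (d : Γ.D) : ρ.liftKQ (Γ.qArr d) = ρ.a d := by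
  by_cases h : Γ.Truncated d
  · rw [qArr, dif_pos h, map_zero, ρ.a_of_truncated d h]
  · simp [gens, liftKQ, PathAlgebra.arr, qArr, h]

lemma liftKQ_cyc_pow (d : Γ.D) (m : ℕ) :
    ρ.liftKQ (Γ.cyc d ^ m) = walk Γ.succ ρ.a (Γ.val (Γ.vertex d) * m) d := by
  rw [cyc_pow]
  refine (map_walk _ _ (ρ.liftKQ : Γ.KQ →* R) _ _).trans ?_
  congr 1
  exact funext fun d => ρ.liftKQ_qArr d

/-- The homomorphism from the Brauer graph algebra given by a realization. -/
def lift : Γ.Alg →ₐ[K] R :=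
  RingQuot.liftAlgHom K ⟨ρ.liftKQ, by
    rintro _ _ (⟨d, h, h'⟩ | ⟨d, h, h'⟩ | ⟨d, d', -, -, -, h⟩ | i)
    · rw [map_smul, map_smul, liftKQ_cyc_pow, liftKQ_cyc_pow]
      exact ρ.rel_one d h h'
    · rw [map_mul, liftKQ_cyc_pow, liftKQ_qArr, map_zero]
      exact ρ.rel_two d h h'
    · rw [map_mul, liftKQ_qArr, liftKQ_qArr, map_zero]
      exact ρ.rel_three d d' h
    · rw [map_mul, liftKQ_loop, map_zero]
      exact ρ.x_mul_self i.1⟩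

@[simp]
lemma lift_e (i : Γ.E) : ρ.lift (Γ.e i) = ρ.e i := by
  rw [lift, QuantizedBrauerGraph.e, RingQuot.liftAlgHom_mkAlgHom_apply, liftKQ_vert]

@[simp]
lemma lift_a (d : Γ.D) : ρ.lift (Γ.a d) = ρ.a d := by
  rw [lift, QuantizedBrauerGraph.a, RingQuot.liftAlgHom_mkAlgHom_apply, liftKQ_qArr]

@[simp]
lemma lift_x (i : Γ.E) : ρ.lift (Γ.x i) = ρ.x i := by
  by_cases h : Γ.BiTruncated i
  · rw [lift, QuantizedBrauerGraph.x, dif_pos h, RingQuot.liftAlgHom_mkAlgHom_apply, liftKQ_loop]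
  · rw [QuantizedBrauerGraph.x_of_not _ h, map_zero, ρ.x_of_not i h]

end Realization

open Classical in
/-- The one-dimensional realization supported at the vertex `i` of the quiver. -/
def pointRealization (i : Γ.E) : Γ.Realization K where
  e j := if j = i then 1 else 0
  a _ := 0
  x _ := 0
  e_sum := by simp
  e_mul_self j := by simp
  e_mul_of_ne j k h := by
    by_cases hj : j = i
    · subst hj
      simp [h.symm]
    · simp [hj]
  e_mul_a _ := mul_zero _
  a_mul_e _ := zero_mul _
  e_mul_x _ := mul_zero _
  x_mul_e _ := zero_mul _
  a_of_truncated _ _ := rfl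
  x_of_not _ _ := rfl
  rel_one d _ _ := by
    obtain ⟨n, hn⟩ := Nat.exists_eq_succ_of_ne_zero
      (Nat.mul_pos (Γ.val_pos (Γ.vertex d)) (Γ.mult_pos (Γ.vertex d))).ne'
    obtain ⟨n', hn'⟩ := Nat.exists_eq_succ_of_ne_zero
      (Nat.mul_pos (Γ.val_pos (Γ.vertex (Γ.flip d))) (Γ.mult_pos (Γ.vertex (Γ.flip d)))).ne'
    simp only [hn, hn', walk, zero_mul, smul_zero]
  rel_two _ _ _ := mul_zero _
  rel_three _ _ _ := mul_zero _
  x_mul_self _ := mul_zero _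

/-- The character `Γ.Alg → K` that is `1` on the idempotent of `i` and `0` on all other idempotents
and all arrows. -/
def point (i : Γ.E) : Γ.Alg →ₐ[K] K := (Γ.pointRealization i).lift

open Classical in
lemma point_e (i j : Γ.E) : Γ.point i (Γ.e j) = if j = i then 1 else 0 :=
  (Γ.pointRealization i).lift_e j

lemma point_a (i : Γ.E) (d : Γ.D) : Γ.point i (Γ.a d) = 0 := (Γ.pointRealization i).lift_a d

lemma point_x (i j : Γ.E) : Γ.point i (Γ.x j) = 0 := (Γ.pointRealization i).lift_x j

/-- The algebra acts on a simple module through one of the characters `Γ.point i`. -/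
lemma exists_smul_eq_point {S : Type*} [AddCommGroup S] [Module K S] [Module Γ.Alg S]
    [IsScalarTower K Γ.Alg S] [IsSimpleModule Γ.Alg S] :
    ∃ i, ∀ (r : Γ.Alg) (s : S), r • s = Γ.point i r • s := by
  classical
  obtain ⟨hr, i, hi⟩ := Γ.isArrowGenerated.exists_vertex (M := S)
  refine ⟨i, fun r s => ?_⟩
  have hmem : r ∈ Algebra.adjoin K (Set.range Γ.e ∪ Set.range Γ.arrows) := by
    rw [Γ.adjoin_eq_top]; trivial
  induction hmem using Algebra.adjoin_induction generalizing s with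
  | mem b hb =>
    rcases hb with ⟨j, rfl⟩ | ⟨d | j, rfl⟩
    · rw [point_e]
      split_ifs with h
      · rw [h, hi, one_smul]
      · rw [Γ.isArrowGenerated.smul_eq_zero_of_ne h hi, zero_smul]
    · rw [hr, arrows, Sum.elim_inl, point_a, zero_smul]
    · rw [hr, arrows, Sum.elim_inr, point_x, zero_smul]
  | algebraMap c => rw [algebraMap_smul, AlgHom.commutes, algebraMap_smul]
  | add b c _ _ h1 h2 => rw [add_smul, map_add, add_smul, h1, h2]
  | mul b c _ _ h1 h2 => rw [mul_smul, map_mul, mul_smul, h1, h2]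

end Generation

end QuantizedBrauerGraph

/-! ### The algebra of a covering as a module over the algebra of the base -/

namespace QuantizedBrauerGraph

variable {K : Type u} [Field K] {Γ : QuantizedBrauerGraph.{u, v} K} {G : Type v} [CommGroup G]
  [Fintype G] (W : Γ.toBrauerGraph.Weighting G)

section Matrix

variable [DecidableEq G]

/-- The matrix over `A_Γ` by which the arrow `d_g` of the covering acts: the entry `a_d` in
position `(g, g W(d))`. -/
def shiftArrow (p : Γ.D × G) : Matrix G G Γ.Alg :=
  Matrix.single p.2 (p.2 * W.weight p.1) (Γ.a p.1)

open Finset in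
lemma walk_shiftArrow (n : ℕ) (d : Γ.D) (g : G) :
    walk W.coverSucc (shiftArrow W) (n + 1) (d, g) =
      Matrix.single g (g * ∏ k ∈ range (n + 1), W.weight ((Γ.succ ^ k) d))
        (walk Γ.succ Γ.a (n + 1) d) := by
  induction n generalizing d g with
  | zero => simp [walk, shiftArrow]
  | succ n ih =>
    rw [walk, show W.coverSucc (d, g) = (Γ.succ d, g * W.weight d) from rfl, ih, shiftArrow,
      Matrix.single_mul_single_same, walk, mul_assoc g,
      prod_range_succ' (fun k => W.weight ((Γ.succ ^ k) d))]
    simp only [pow_succ, Equiv.Perm.mul_apply, pow_zero, Equiv.Perm.one_apply]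
    rw [mul_comm (W.weight d)]
    rfl

/-- The walk `C ^ m` around a vertex returns to the same element of `G`, since the order of the weight
of `C` divides `m`. -/
lemma walk_shiftArrow_loop (d : Γ.D) (g : G) :
    walk (cover W).succ (shiftArrow W) ((cover W).val ((cover W).vertex (half W d g)) *
        (cover W).mult ((cover W).vertex (half W d g))) (half W d g) =
      Matrix.single g g (walk Γ.succ Γ.a (Γ.val (Γ.vertex d) * Γ.mult (Γ.vertex d)) d) := by
  have h1 : (cover W).val ((cover W).vertex (half W d g)) *
      (cover W).mult ((cover W).vertex (half W d g)) =
        Γ.val (Γ.vertex d) * Γ.mult (Γ.vertex d) := W.val_mul_mult d g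
  have h2 : g * ∏ k ∈ Finset.range (Γ.val (Γ.vertex d) * Γ.mult (Γ.vertex d)),
      W.weight ((Γ.succ ^ k) d) = g := by
    rw [Γ.prod_val_mul, orderOf_dvd_iff_pow_eq_one.1 (W.order_dvd _), mul_one]
  rw [h1]
  obtain ⟨n, hn⟩ := Nat.exists_eq_succ_of_ne_zero
    (Nat.mul_pos (Γ.val_pos (Γ.vertex d)) (Γ.mult_pos (Γ.vertex d))).ne'
  rw [hn] at h2 ⊢
  exact (walk_shiftArrow W n d g).trans (by rw [h2])

/-- The realization of the algebra of the covering by `G × G`-matrices over `A_Γ`; its image lies in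
the smash product of `A_Γ` with the dual of the group algebra of `G`. -/
def shiftRealization : (cover W).Realization (Matrix G G Γ.Alg) where
  e (p : Γ.E × G) := Matrix.single p.2 p.2 (Γ.e p.1)
  a := shiftArrow W
  x (p : Γ.E × G) := Matrix.single p.2 p.2 (Γ.x p.1)
  e_sum := by
    refine (Fintype.sum_prod_type_right
      (fun p : Γ.E × G => Matrix.single p.2 p.2 (Γ.e p.1))).trans ?_
    rw [← Matrix.sum_single_one]
    refine Finset.sum_congr rfl fun g _ => ?_
    rw [← Γ.e_sum]
    exact (map_sum (Matrix.singleAddMonoidHom g g) Γ.e Finset.univ).symm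
  e_mul_self := by
    rintro ⟨i, g⟩
    rw [Matrix.single_mul_single_same, e_mul_self]
  e_mul_of_ne := by
    rintro ⟨i, g⟩ ⟨j, h⟩ hne
    by_cases hgh : g = h
    · subst hgh
      rw [Matrix.single_mul_single_same, Γ.e_mul_of_ne (fun H => hne (Prod.ext H rfl)),
        Matrix.single_zero]
    · exact Matrix.single_mul_single_of_ne _ _ _ _ hgh _
  e_mul_a := by
    rintro ⟨d, g⟩
    exact (Matrix.single_mul_single_same _ _ _ _ _).trans
      (congrArg (Matrix.single g (g * W.weight d)) (Γ.e_mul_a d))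
  a_mul_e := by
    rintro ⟨d, g⟩
    exact (Matrix.single_mul_single_same _ _ _ _ _).trans
      (congrArg (Matrix.single g (g * W.weight d)) (Γ.a_mul_e d))
  e_mul_x := by
    rintro ⟨i, g⟩
    rw [Matrix.single_mul_single_same, e_mul_x]
  x_mul_e := by
    rintro ⟨i, g⟩
    rw [Matrix.single_mul_single_same, x_mul_e]
  a_of_truncated := by
    rintro ⟨d, g⟩ h
    rw [shiftArrow, Γ.a_of_truncated ((truncated_half W d g).1 h), Matrix.single_zero]
  x_of_not := by
    rintro ⟨i, g⟩ h
    rw [Γ.x_of_not fun H => h ((biTruncated_edgeAt W i g).2 H), Matrix.single_zero]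
  rel_one := by
    rintro ⟨d, g⟩ h h'
    refine (congrArg _ (walk_shiftArrow_loop W d g)).trans
      (Eq.trans ?_ (congrArg _ (walk_shiftArrow_loop W (Γ.flip d) g).symm))
    rw [Matrix.smul_single, Matrix.smul_single]
    exact congrArg _ (Γ.rel_one d (fun H => h ((truncated_half W d g).2 H))
      (fun H => h' ((truncated_half W _ g).2 H)))
  rel_two := by
    rintro ⟨d, g⟩ h h'
    refine (congrArg (· * _) (walk_shiftArrow_loop W d g)).trans ?_
    simp only [shiftArrow]
    rw [Matrix.single_mul_single_same, Γ.walk_mul_a_eq_zero, Matrix.single_zero]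
  rel_three := by
    rintro ⟨d, g⟩ ⟨d', g'⟩ hne
    simp only [shiftArrow]
    by_cases hg : g * W.weight d = g'
    · subst hg
      rw [Matrix.single_mul_single_same, Γ.rel_three d d', Matrix.single_zero]
      rintro rfl
      exact hne rfl
    · exact Matrix.single_mul_single_of_ne _ _ _ _ hg _
  x_mul_self := by
    rintro ⟨i, g⟩
    rw [Matrix.single_mul_single_same, x_mul_self, Matrix.single_zero]

/-- The homomorphism `A_{Γ_W} → Matrix G G A_Γ` of `shiftRealization`. -/
def shiftHom : (cover W).Alg →ₐ[K] Matrix G G Γ.Alg := (shiftRealization W).lift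

lemma shiftHom_e (i : Γ.E) (g : G) :
    shiftHom W ((cover W).e (edgeAt W i g)) = Matrix.single g g (Γ.e i) :=
  (shiftRealization W).lift_e (edgeAt W i g)

lemma shiftHom_a (d : Γ.D) (g : G) :
    shiftHom W ((cover W).a (half W d g)) = Matrix.single g (g * W.weight d) (Γ.a d) :=
  (shiftRealization W).lift_a (half W d g)

lemma shiftHom_x (i : Γ.E) (g : G) :
    shiftHom W ((cover W).x (edgeAt W i g)) = Matrix.single g g (Γ.x i) :=
  (shiftRealization W).lift_x (edgeAt W i g)

lemma shiftHom_idem (g : G) : shiftHom W (idem W g) = Matrix.single g g 1 := by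
  rw [idem, map_sum, ← Γ.e_sum]
  simp only [shiftHom_e]
  exact (map_sum (Matrix.singleAddMonoidHom g g) Γ.e Finset.univ).symm

/-- If every column of a matrix has the single nonzero entry `r`, multiplication by it multiplies
column sums by `r`. -/
lemma sum_single_mul_col (f : G → G) (hf : Function.Bijective f) (r : Γ.Alg)
    (Y : Matrix G G Γ.Alg) (h : G) :
    ∑ g, ((∑ k, Matrix.single k (f k) r) * Y) g h = r * ∑ g, Y g h := by
  have key : ∀ g, ((∑ k, Matrix.single k (f k) r) * Y) g h = r * Y (f g) h := by
    intro g
    rw [Finset.sum_mul, Matrix.sum_apply, Finset.sum_eq_single g]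
    · rw [Matrix.single_mul_apply_same]
    · intro k _ hk
      exact Matrix.single_mul_apply_of_ne _ _ _ _ _ hk.symm _
    · simp
  simp only [key]
  rw [← Finset.mul_sum]
  congr 1
  exact hf.sum_comp (fun g => Y g h)

/-- Every column of the matrix of `coverHom W r` sums to `r`, so that taking column sums is linear
over `A_Γ`. -/
lemma sum_shiftHom_coverHom_mul (r : Γ.Alg) (Y : Matrix G G Γ.Alg) (h : G) :
    ∑ g, (shiftHom W (coverHom W r) * Y) g h = r * ∑ g, Y g h := by
  have hmem : r ∈ Algebra.adjoin K (Set.range Γ.e ∪ Set.range Γ.arrows) := by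
    rw [Γ.adjoin_eq_top]; trivial
  induction hmem using Algebra.adjoin_induction generalizing Y with
  | mem r hr =>
    rcases hr with ⟨i, rfl⟩ | ⟨d | i, rfl⟩
    · rw [coverHom_e, eSum, map_sum]
      simp only [shiftHom_e]
      exact sum_single_mul_col (fun g => g) Function.bijective_id _ _ _
    · rw [arrows, Sum.elim_inl, coverHom_a, aSum, map_sum]
      simp only [shiftHom_a]
      exact sum_single_mul_col (· * W.weight d) (Group.mulRight_bijective _) _ _ _
    · rw [arrows, Sum.elim_inr, coverHom_x, xSum, map_sum]
      simp only [shiftHom_x]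
      exact sum_single_mul_col (fun g => g) Function.bijective_id _ _ _
  | algebraMap c =>
    rw [AlgHom.commutes, AlgHom.commutes, ← Algebra.smul_def, ← Algebra.smul_def, Finset.smul_sum]
    rfl
  | add r s _ _ h1 h2 =>
    simp only [map_add, add_mul, Matrix.add_apply, Finset.sum_add_distrib, h1, h2]
  | mul r s _ _ h1 h2 => rw [map_mul, map_mul, mul_assoc, h1, h2, mul_assoc]

end Matrix

/-- The algebra `A_Γ` is spanned by paths, so in particular by homogeneous elements. -/
lemma span_isPath_eq_top : Submodule.span K {p : Γ.Alg | ∃ h, IsPath W h p} = ⊤ := by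
  refine eq_top_iff.2 fun r _ => ?_
  rw [← mul_one r]
  have hstable : ∀ b : Γ.Alg, (∀ h p, IsPath W h p →
      b * p ∈ Submodule.span K {p : Γ.Alg | ∃ h, IsPath W h p}) → ∀ m ∈
      Submodule.span K {p : Γ.Alg | ∃ h, IsPath W h p},
        b • m ∈ Submodule.span K {p : Γ.Alg | ∃ h, IsPath W h p} := by
    intro b hb m hm
    have : Submodule.span K {p : Γ.Alg | ∃ h, IsPath W h p} ≤
        (Submodule.span K {p : Γ.Alg | ∃ h, IsPath W h p}).comap (LinearMap.mulLeft K b) :=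
      Submodule.span_le.2 fun p ⟨h, hp⟩ => hb h p hp
    exact this hm
  refine Γ.isArrowGenerated.smul_mem_of_stable (M := Γ.Alg) _
    (fun i => hstable _ ?_) (fun x => hstable _ ?_) r 1 ?_
  · intro h p hp
    have he : ∀ j, ∀ q, Γ.e j * q = q → IsPath W h q →
        Γ.e i * q ∈ Submodule.span K {p : Γ.Alg | ∃ h, IsPath W h p} := by
      intro j q hq hpath
      by_cases hij : i = j
      · rw [hij, hq]
        exact Submodule.subset_span ⟨h, hpath⟩
      · rw [← hq, ← mul_assoc, Γ.e_mul_of_ne hij, zero_mul]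
        exact Submodule.zero_mem _
    cases hp with
    | vertex j => exact he j _ (Γ.e_mul_self j) (.vertex j)
    | arrow d h p hp => exact he _ _ (by rw [← mul_assoc, e_mul_a]) (.arrow d h p hp)
    | loop j h p hp => exact he j _ (by rw [← mul_assoc, e_mul_x]) (.loop j _ p hp)
  · intro h p hp
    rcases x with d | i
    · exact Submodule.subset_span ⟨_, .arrow d h p hp⟩
    · exact Submodule.subset_span ⟨_, .loop i h p hp⟩
  · rw [← Γ.e_sum]
    exact Submodule.sum_mem _ fun i _ => Submodule.subset_span ⟨1, .vertex i⟩

lemma coverHom_e_mul_idem (i : Γ.E) (g : G) :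
    coverHom W (Γ.e i) * idem W g = (cover W).e (edgeAt W i g) := by
  rw [coverHom_e, eSum, Finset.sum_mul, Finset.sum_eq_single g]
  · exact mul_idem W i g _ ((cover W).e_mul_self _)
  · intro h _ hne
    exact mul_idem_of_ne W i h g hne _ ((cover W).e_mul_self _)
  · simp

lemma coverHom_a_mul_idem (d : Γ.D) (g : G) :
    coverHom W (Γ.a d) * idem W (g * W.weight d) = (cover W).a (half W d g) := by
  rw [coverHom_a, aSum, Finset.sum_mul, Finset.sum_eq_single g]
  · exact mul_idem W (Γ.edge (Γ.succ d)) _ _ ((cover W).a_mul_e (half W d g))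
  · intro h _ hne
    exact mul_idem_of_ne W (Γ.edge (Γ.succ d)) (h * W.weight d) _
      (fun H => hne (mul_right_cancel H)) _ ((cover W).a_mul_e (half W d h))
  · simp

lemma coverHom_x_mul_idem (i : Γ.E) (g : G) :
    coverHom W (Γ.x i) * idem W g = (cover W).x (edgeAt W i g) := by
  rw [coverHom_x, xSum, Finset.sum_mul, Finset.sum_eq_single g]
  · exact mul_idem W i g _ ((cover W).x_mul_e _)
  · intro h _ hne
    exact mul_idem_of_ne W i h g hne _ ((cover W).x_mul_e _)
  · simp

/-- Every arrow of the covering is the image of an arrow of the base times an element. -/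
lemma exists_arrow_eq (p : (cover W).D ⊕ (cover W).E) :
    ∃ x, ∃ b, (cover W).arrows p = coverHom W (Γ.arrows x) * b := by
  rcases p with ⟨d, g⟩ | ⟨i, g⟩
  · exact ⟨Sum.inl d, _, (coverHom_a_mul_idem W d g).symm⟩
  · exact ⟨Sum.inr i, _, (coverHom_x_mul_idem W i g).symm⟩

/-- The algebra of the covering is generated as a left `A_Γ`-module by the idempotents `idem g`. -/
lemma span_coverHom_mul_idem_eq_top :
    Submodule.span K (Set.range fun p : Γ.Alg × G => coverHom W p.1 * idem W p.2) = ⊤ := by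
  set L := Submodule.span K (Set.range fun p : Γ.Alg × G => coverHom W p.1 * idem W p.2) with hL
  have hmem : ∀ r g, coverHom W r * idem W g ∈ L := fun r g => Submodule.subset_span ⟨(r, g), rfl⟩
  have hstable : ∀ b : (cover W).Alg, (∀ r g, b * (coverHom W r * idem W g) ∈ L) →
      ∀ m ∈ L, b * m ∈ L := by
    intro b hb m hm
    have : L ≤ L.comap (LinearMap.mulLeft K b) :=
      Submodule.span_le.2 (by rintro _ ⟨⟨r, g⟩, rfl⟩; exact hb r g)
    exact this hm
  have hcover : ∀ (s : Γ.Alg), ∀ m ∈ L, coverHom W s * m ∈ L := fun s => hstable _ fun r g => by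
    rw [← mul_assoc, ← map_mul]
    exact hmem _ _
  have hidem : ∀ (k : G), ∀ m ∈ L, idem W k * m ∈ L := fun k => hstable _ fun r g => by
    have hr : r ∈ Submodule.span K {p : Γ.Alg | ∃ h, IsPath W h p} := by
      rw [span_isPath_eq_top]; trivial
    induction hr using Submodule.span_induction with
    | mem p hp =>
      obtain ⟨h, hp⟩ := hp
      rw [← mul_assoc, idem_mul_coverHom W (h := h) (Submodule.subset_span hp), mul_assoc]
      by_cases hk : k * h = g
      · rw [hk, idem_mul_self]
        exact hmem _ _
      · rw [idem_mul_idem W hk, mul_zero]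
        exact L.zero_mem
    | zero => simp
    | add r s _ _ h1 h2 =>
      rw [map_add, add_mul, mul_add]
      exact L.add_mem h1 h2
    | smul c r _ h1 =>
      rw [map_smul, smul_mul_assoc, mul_smul_comm]
      exact L.smul_mem c h1
  refine eq_top_iff.2 fun b _ => ?_
  rw [← mul_one b]
  refine (cover W).isArrowGenerated.smul_mem_of_stable (M := (cover W).Alg) L ?_ ?_ b 1 ?_
  · rintro ⟨i, g⟩ m hm
    change (cover W).e (edgeAt W i g) * m ∈ L
    rw [← coverHom_e_mul_idem, mul_assoc]
    exact hcover _ _ (hidem _ _ hm)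
  · rintro (⟨d, g⟩ | ⟨i, g⟩) m hm
    · change (cover W).a (half W d g) * m ∈ L
      rw [← coverHom_a_mul_idem, mul_assoc]
      exact hcover _ _ (hidem _ _ hm)
    · change (cover W).x (edgeAt W i g) * m ∈ L
      rw [← coverHom_x_mul_idem, mul_assoc]
      exact hcover _ _ (hidem _ _ hm)
  · rw [← idem_sum W]
    refine L.sum_mem fun g _ => ?_
    have := hmem 1 g
    rwa [map_one, one_mul] at this

/-- The algebra of the covering, as a left module over the algebra of the base. -/
abbrev coverModule : Module Γ.Alg (cover W).Alg :=
  Module.compHom (cover W).Alg (coverHom W).toRingHom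

/-- As a left `A_Γ`-module, the algebra of the covering is a direct summand of `A_Γ ^ G` (in fact
isomorphic to it): taking column sums of matrices has `r ↦ ∑ h, r h • idem h` as a left inverse. -/
lemma projective_cover :
    letI := coverModule W
    Module.Projective Γ.Alg (cover W).Alg := by
  classical
  let _ := coverModule W
  let f : (cover W).Alg →ₗ[Γ.Alg] (G → Γ.Alg) :=
    { toFun := fun y h => ∑ g, shiftHom W y g h
      map_add' := fun y z => by
        ext h
        simp only [map_add, Matrix.add_apply, Finset.sum_add_distrib, Pi.add_apply]
      map_smul' := fun r y => by
        ext h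
        change ∑ g, shiftHom W (coverHom W r * y) g h = r * ∑ g, shiftHom W y g h
        rw [map_mul, sum_shiftHom_coverHom_mul] }
  let s : (G → Γ.Alg) →ₗ[Γ.Alg] (cover W).Alg :=
    { toFun := fun r => ∑ h, coverHom W (r h) * idem W h
      map_add' := fun r r' => by
        simp only [Pi.add_apply, map_add, add_mul, Finset.sum_add_distrib]
      map_smul' := fun r r' => by
        change _ = coverHom W r * _
        simp only [Pi.smul_apply, smul_eq_mul, map_mul, Finset.mul_sum, mul_assoc] }
  have hf : ∀ h, f (idem W h) = Pi.single h 1 := by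
    intro h
    ext k
    change ∑ g, shiftHom W (idem W h) g k = _
    rw [shiftHom_idem, Finset.sum_eq_single h]
    · by_cases hk : h = k
      · subst hk
        simp
      · rw [Matrix.single_apply_of_col_ne _ _ hk, Pi.single_eq_of_ne (Ne.symm hk)]
    · intro g _ hg
      exact Matrix.single_apply_of_row_ne hg.symm _ _ _
    · simp
  have hs : ∀ h, s (Pi.single h 1) = idem W h := by
    intro h
    change ∑ k, coverHom W ((Pi.single h 1 : G → Γ.Alg) k) * idem W k = _
    rw [Finset.sum_eq_single h]
    · simp
    · intro k _ hk
      rw [Pi.single_eq_of_ne hk, map_zero, zero_mul]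
    · simp
  refine Module.Projective.of_split f s (LinearMap.ext fun y => ?_)
  have hy : y ∈ Submodule.span K
      (Set.range fun p : Γ.Alg × G => coverHom W p.1 * idem W p.2) := by
    rw [span_coverHom_mul_idem_eq_top]; trivial
  change s (f y) = y
  induction hy using Submodule.span_induction with
  | mem y hy =>
    obtain ⟨⟨r, g⟩, rfl⟩ := hy
    change s (f (r • idem W g)) = r • idem W g
    rw [map_smul, map_smul, hf, hs]
  | zero => rw [map_zero, map_zero]
  | add y z _ _ h1 h2 => rw [map_add, map_add, h1, h2]
  | smul c y _ h1 =>
    have hc : c • y = algebraMap K Γ.Alg c • y := by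
      change c • y = coverHom W (algebraMap K Γ.Alg c) * y
      rw [AlgHom.commutes, Algebra.smul_def]
    rw [hc, map_smul, map_smul, h1]

end QuantizedBrauerGraph

/-! ### One covering step -/

namespace QuantizedBrauerGraph

variable {K : Type u} [Field K] {Γ : QuantizedBrauerGraph.{u, v} K} {G : Type v} [CommGroup G]
  [Fintype G] (W : Γ.toBrauerGraph.Weighting G)

lemma projective_forgetful_obj (P : ModuleCat.{w} (cover W).Alg)
    (hP : Module.Projective (cover W).Alg P) :
    Module.Projective Γ.Alg ((forgetful W).obj P) := by
  let _ := coverModule W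
  let _ : Module Γ.Alg P := Module.compHom P (coverHom W).toRingHom
  have : IsScalarTower Γ.Alg (cover W).Alg (cover W).Alg := ⟨fun r y z => mul_assoc _ _ _⟩
  have : IsScalarTower Γ.Alg (cover W).Alg P := ⟨fun r y z => mul_smul _ _ _⟩
  have := projective_cover W
  exact Module.Projective.of_scalarTower Γ.Alg (cover W).Alg (M := P)

lemma isSuperfluous_forgetful_map {P Q : ModuleCat.{w} (cover W).Alg} (f : P ⟶ Q)
    (hf : IsSuperfluous (LinearMap.ker f.hom)) :
    IsSuperfluous (LinearMap.ker ((forgetful W).map f).hom) := by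
  let _ := coverModule W
  let _ : Module Γ.Alg P := Module.compHom P (coverHom W).toRingHom
  let _ : Module K P := Module.compHom P (algebraMap K (cover W).Alg)
  have : IsScalarTower Γ.Alg (cover W).Alg P := ⟨fun r y z => mul_smul _ _ _⟩
  have : IsScalarTower K (cover W).Alg P := ⟨fun c y z => by
    rw [Algebra.smul_def, mul_smul]; rfl⟩
  have : IsScalarTower K Γ.Alg P := ⟨fun c y z => by
    change coverHom W (c • y) • z = algebraMap K (cover W).Alg c • coverHom W y • z
    rw [map_smul, Algebra.smul_def, mul_smul]⟩
  -- restriction of scalars does not change the kernel as a set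
  let N : Submodule Γ.Alg P := LinearMap.ker ((forgetful W).map f).hom
  have hN := Γ.isArrowGenerated.isSuperfluous_of_scalarTower
    (cover W).isArrowGenerated (exists_arrow_eq W) (LinearMap.ker f.hom) N (fun m hm => hm) hf
  exact hN

lemma isSimpleModule_forgetful_obj (S : ModuleCat.{w} (cover W).Alg)
    (hS : IsSimpleModule (cover W).Alg S) : IsSimpleModule Γ.Alg ((forgetful W).obj S) := by
  let _ : Module Γ.Alg S := Module.compHom S (coverHom W).toRingHom
  let _ : Module K S := Module.compHom S (algebraMap K (cover W).Alg)
  have : IsScalarTower K (cover W).Alg S := ⟨fun c y z => by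
    rw [Algebra.smul_def, mul_smul]; rfl⟩
  have : IsScalarTower K Γ.Alg S := ⟨fun c y z => by
    change coverHom W (c • y) • z = algebraMap K (cover W).Alg c • coverHom W y • z
    rw [map_smul, Algebra.smul_def, mul_smul]⟩
  have := (cover W).isArrowGenerated.isSimpleModule_field K S
  exact IsSimpleModule.of_scalarTower K Γ.Alg (S := S)

lemma point_edgeAt_coverHom (i : Γ.E) (g : G) (r : Γ.Alg) :
    (cover W).point (edgeAt W i g) (coverHom W r) = Γ.point i r := by
  classical
  have h : ((cover W).point (edgeAt W i g)).comp (coverHom W) = Γ.point i := by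
    refine AlgHom.ext_of_adjoin_eq_top Γ.adjoin_eq_top ?_
    rintro _ (⟨j, rfl⟩ | ⟨d | j, rfl⟩)
    · rw [AlgHom.comp_apply, coverHom_e, eSum, map_sum, point_e, Finset.sum_eq_single g]
      · simp only [point_e, edgeAt_inj, and_true]
      · intro h _ hne
        rw [point_e, if_neg (by rw [edgeAt_inj]; tauto)]
      · simp
    · rw [arrows, Sum.elim_inl, AlgHom.comp_apply, coverHom_a, aSum, map_sum, point_a]
      exact Finset.sum_eq_zero fun g _ => point_a _ _ _
    · rw [arrows, Sum.elim_inr, AlgHom.comp_apply, coverHom_x, xSum, map_sum, point_x]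
      exact Finset.sum_eq_zero fun g _ => point_x _ _ _
  exact AlgHom.congr_fun h r

/-- A simple module at the vertex `i` lifts to the simple module on the same space at the vertex
`i_1` of the covering. -/
lemma exists_simple_forgetful_iso (S : ModuleCat.{w} Γ.Alg) (hS : IsSimpleModule Γ.Alg S) :
    ∃ T : ModuleCat.{w} (cover W).Alg, IsSimpleModule (cover W).Alg T ∧
      Nonempty ((forgetful W).obj T ≅ S) := by
  let _ : Module K S := Module.compHom S (algebraMap K Γ.Alg)
  have : IsScalarTower K Γ.Alg S := ⟨fun c y z => by
    rw [Algebra.smul_def, mul_smul]; rfl⟩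
  obtain ⟨i, hi⟩ := Γ.exists_smul_eq_point (S := S)
  have := Γ.isArrowGenerated.isSimpleModule_field K S
  let χ := (cover W).point (edgeAt W i 1)
  let mod : Module (cover W).Alg S := Module.compHom S χ.toRingHom
  have : IsScalarTower K (cover W).Alg S := ⟨fun c y z => by
    change χ (c • y) • z = c • χ y • z
    rw [map_smul, smul_assoc]⟩
  let E : (forgetful W).obj (ModuleCat.of (cover W).Alg S) ≃ₗ[Γ.Alg] S :=
    { toFun := fun s => s
      invFun := fun s => s
      left_inv := fun _ => rfl
      right_inv := fun _ => rfl
      map_add' := fun _ _ => rfl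
      map_smul' := fun r (s : S) => by
        change (cover W).point (edgeAt W i 1) (coverHom W r) • s = r • s
        rw [point_edgeAt_coverHom, hi] }
  exact ⟨ModuleCat.of (cover W).Alg S, IsSimpleModule.of_scalarTower K (cover W).Alg (S := S),
    ⟨E.toModuleIso⟩⟩

lemma isMinimalProjectiveResolution_forgetful {P : ℕ → ModuleCat.{w} (cover W).Alg}
    {d : ∀ n, P (n + 1) ⟶ P n} {T : ModuleCat.{w} (cover W).Alg} {ε : P 0 ⟶ T}
    (h : IsMinimalProjectiveResolution P d ε) :
    IsMinimalProjectiveResolution (fun k => (forgetful W).obj (P k))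
      (fun k => (forgetful W).map (d k)) ((forgetful W).map ε) where
  projective n := projective_forgetful_obj W (P n) (h.projective n)
  surjective := h.surjective
  exact_zero := h.exact_zero
  exact_succ := h.exact_succ
  minimal_zero := isSuperfluous_forgetful_map W ε h.minimal_zero
  minimal_succ n := isSuperfluous_forgetful_map W (d n) (h.minimal_succ n)

end QuantizedBrauerGraph

/-! ### Towers of coverings -/

lemma IsMinimalProjectiveResolution.comp_iso {R : Type*} [Ring R] {P : ℕ → ModuleCat.{w} R}
    {d : ∀ n, P (n + 1) ⟶ P n} {T S : ModuleCat.{w} R} {ε : P 0 ⟶ T}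
    (h : IsMinimalProjectiveResolution P d ε) (φ : T ≅ S) :
    IsMinimalProjectiveResolution P d (ε ≫ φ.hom) := by
  have hφ : Function.Bijective φ.hom := ConcreteCategory.bijective_of_isIso φ.hom
  have hker : LinearMap.ker (ε ≫ φ.hom).hom = LinearMap.ker ε.hom := by
    ext m
    exact map_eq_zero_iff φ.hom.hom hφ.1
  exact
    { projective := h.projective
      surjective := hφ.2.comp h.surjective
      exact_zero := fun m => (map_eq_zero_iff φ.hom.hom hφ.1).trans (h.exact_zero m)
      exact_succ := h.exact_succ
      minimal_zero := hker ▸ h.minimal_zero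
      minimal_succ := h.minimal_succ }

namespace BrauerTower

variable {K : Type u} [Field K] {n : ℕ} {Δ₀ Δ : QuantizedBrauerGraph.{u, v} K}
  (t : BrauerTower K n Δ₀ Δ)

lemma exact_functor_map {X Y Z : ModuleCat.{w} Δ.Alg} {f : X ⟶ Y} {g : Y ⟶ Z}
    (h : Function.Exact f g) : Function.Exact (t.functor.map f) (t.functor.map g) := by
  induction t with
  | base Δ => exact h
  | step t G W ih =>
    exact ih (f := (QuantizedBrauerGraph.forgetful W).map f)
      (g := (QuantizedBrauerGraph.forgetful W).map g) h

lemma isSimpleModule_functor_obj (S : ModuleCat.{w} Δ.Alg) (hS : IsSimpleModule Δ.Alg S) :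
    IsSimpleModule Δ₀.Alg (t.functor.obj S) := by
  induction t with
  | base Δ => exact hS
  | step t G W ih => exact ih _ (QuantizedBrauerGraph.isSimpleModule_forgetful_obj W S hS)

lemma exists_simple_functor_iso (S : ModuleCat.{w} Δ₀.Alg) (hS : IsSimpleModule Δ₀.Alg S) :
    ∃ T : ModuleCat.{w} Δ.Alg, IsSimpleModule Δ.Alg T ∧ Nonempty (t.functor.obj T ≅ S) := by
  induction t with
  | base Δ => exact ⟨S, hS, ⟨Iso.refl S⟩⟩
  | step t G W ih =>
    obtain ⟨T, hT, ⟨φ⟩⟩ := ih S hS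
    obtain ⟨T', hT', ⟨ψ⟩⟩ := QuantizedBrauerGraph.exists_simple_forgetful_iso W T hT
    exact ⟨T', hT', ⟨t.functor.mapIso ψ ≪≫ φ⟩⟩

lemma isMinimalProjectiveResolution_functor {P : ℕ → ModuleCat.{w} Δ.Alg}
    {d : ∀ n, P (n + 1) ⟶ P n} {T : ModuleCat.{w} Δ.Alg} {ε : P 0 ⟶ T}
    (h : IsMinimalProjectiveResolution P d ε) :
    IsMinimalProjectiveResolution (fun k => t.functor.obj (P k))
      (fun k => t.functor.map (d k)) (t.functor.map ε) := by
  induction t with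
  | base Δ => exact h
  | step t G W ih => exact ih (QuantizedBrauerGraph.isMinimalProjectiveResolution_forgetful W h)

end BrauerTower

theorem mainTheorem8 {K : Type u} [Field K] (n : ℕ) (hn : 0 < n)
    (Δ₀ Δₙ : QuantizedBrauerGraph.{u, v} K) (t : BrauerTower K n Δ₀ Δₙ) :
    -- the functor is exact
    (∀ (X Y Z : ModuleCat.{w} Δₙ.Alg) (f : X ⟶ Y) (g : Y ⟶ Z), Function.Exact f g →
      Function.Exact (t.functor.map f) (t.functor.map g)) ∧
    -- simple modules at the bottom, and minimal projective resolutions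
    (∀ S : ModuleCat.{w} Δ₀.Alg, IsSimpleModule Δ₀.Alg S →
      (∃ T : ModuleCat.{w} Δₙ.Alg, IsSimpleModule Δₙ.Alg T ∧ Nonempty (t.functor.obj T ≅ S)) ∧
      ∀ T : ModuleCat.{w} Δₙ.Alg, IsSimpleModule Δₙ.Alg T → ∀ φ : t.functor.obj T ≅ S,
        ∀ (P : ℕ → ModuleCat.{w} Δₙ.Alg) (d : ∀ k, P (k + 1) ⟶ P k) (ε : P 0 ⟶ T),
          IsMinimalProjectiveResolution P d ε →
          IsMinimalProjectiveResolution (fun k => t.functor.obj (P k))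
            (fun k => t.functor.map (d k)) (t.functor.map ε ≫ φ.hom)) ∧
    -- simple modules at the top
    (∀ S' : ModuleCat.{w} Δₙ.Alg, IsSimpleModule Δₙ.Alg S' →
      IsSimpleModule Δ₀.Alg (t.functor.obj S')) := by
  refine ⟨fun X Y Z f g h => t.exact_functor_map h, fun S hS =>
    ⟨t.exists_simple_functor_iso S hS, fun T _ φ P d ε h => ?_⟩, t.isSimpleModule_functor_obj⟩
  exact (t.isMinimalProjectiveResolution_functor h).comp_iso φ

end
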